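/- Let $I=[-1,1]$, and let $D:[0,1]\to[0,1]$ be continuous and non-increasing. Let $0<\delta\le 1$, $\alpha>\delta$ and $\lambda>0$. Let $Y$ be a symmetric real random variable with $E[Y^2]=1$ and $E|Y|^{2+\alpha}<\infty$. For $\gamma\in(0,1/2)$ put $\sigma=\sqrt{\lambda\gamma}$, let $\Theta_\gamma$ be the law of $\sigma Y$, and for $w,w_*\in I$ and $\eta,\eta_*\in\mathbb R$ let $$w'=w-\gamma(w-w_*)+\eta D(|w|),\qquad w_*'=w_*-\gamma(w_*-w)+\eta_*D(|w_*|).$$ Let $\mathcal F_{2+\delta}(I)$ be the set of $\varphi\in C^2(I)$ with $\varphi(\pm1)=\varphi'(\pm1)=0$ and $\varphi''$ Hölder continuous of order $\delta$. Write $\langle\mu,\varphi\rangle=\int_I\varphi\,d\mu$, and equip the set $\mathcal M_0(I)$ of Borel probability measures on $I$ with the topology of weak convergence. A curve $f:[0,\infty)\to\mathcal M_0(I)$ is called $C^1$ if it is continuous and $t\mapsto\langle f(t),\varphi\rangle$ is $C^1$ on $[0,\infty)$ for every $\varphi\in\mathcal F_{2+\delta}(I)$. A weak solution of the Boltzmann-type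 opinion equation with parameter $\gamma$ and initial datum $f_0\in\mathcal M_0(I)$ is a $C^1$ curve $f$ such that, for all $\varphi\in\mathcal F_{2+\delta}(I)$, $\langle f(t),\varphi\rangle\to\langle f_0,\varphi\rangle$ as $t\to0^+$ and, for all $t>0$, $$\frac{d}{dt}\langle f(t),\varphi\rangle=\int_{I^2}\int_{\mathbb R^2}\chi(|w'|\le1)\,\chi(|w_*'|\le1)\,\bigl(\varphi(w')-\varphi(w)\bigr)\,\Theta_\gamma(d\eta)\,\Theta_\gamma(d\eta_*)\,f(t)(dw)\,f(t)(dw_*).$$ Let $f_0\in\mathcal M_0(I)$ satisfy $f_0(\{-1,1\})=0$ (for instance, let $f_0$ have a density), and let $m=\int_I w\,f_0(dw)$. Let $\gamma_n\in(0,1/2)$ with $\gamma_n\to0$, so that $\sigma_n=\sqrt{\lambda\gamma_n}\to0$. Assume that the kernel is Maxwellian for each $\gamma_n$: for all $w,w_*\in I$ and $\Theta_{\gamma_n}$-almost every $\eta$, $|w'|\le1$ (with $\gamma=\gamma_n$). For each $n$ let $f_n$ be a weak solution of the Boltzmann-type equation with parameter $\gamma_n$ and initial datum $f_0$, and let $g_n(\tau)=f_n(\tau/\gamma_n)$.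 Then there are a subsequence $(n_k)$ and a curve $g:[0,\infty)\to\mathcal M_0(I)$ such that 1. $g_{n_k}(\tau)\to g(\tau)$ weakly for every $\tau\ge0$; 2. $g(\tau)(\{-1,1\})=0$ for every $\tau\ge0$; 3. $g$ is a weak solution of the Fokker–Planck equation $$\partial_\tau g=\frac\lambda2\,\partial_w^2\bigl(D(|w|)^2g\bigr)+\partial_w\bigl((w-m)g\bigr)$$ with initial datum $f_0$, that is, $g$ is a $C^1$ curve and, for all $\varphi\in\mathcal F_{2+\delta}(I)$, $\langle g(\tau),\varphi\rangle\to\langle f_0,\varphi\rangle$ as $\tau\to0^+$ and $\frac{d}{d\tau}\langle g(\tau),\varphi\rangle=\int_I\bigl[(m-w)\varphi'(w)+\frac\lambda2D(|w|)^2\varphi''(w)\bigr]g(\tau)(dw)$ for all $\tau>0$; 4. the average opinion is conserved: $\int_I w\,g(\tau)(dw)=m$ for every $\tau\ge0$. -/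

import Mathlib

open MeasureTheory Filter Topology

noncomputable section

/-- The interval `[-1, 1]` of possible opinions. Probability measures on it, with the topology of
weak convergence, are `ProbabilityMeasure Opinion`. -/
abbrev Opinion : Type := ↥(Set.Icc (-1 : ℝ) 1)

/-- The class of test functions `h` on `[-1, 1]` with `h(±1) = h'(±1) = 0` whose `k`-th derivative
is Hölder continuous of order `δ` (only the values of `h` on `[-1, 1]` matter; derivatives at the
end points are one-sided). -/
structure IsTestFunction (k : ℕ) (δ : ℝ) (h : ℝ → ℝ) : Prop where
  contDiffOn : ContDiffOn ℝ k h (Set.Icc (-1) 1)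
  left : h (-1) = 0
  right : h 1 = 0
  deriv_left : derivWithin h (Set.Icc (-1) 1) (-1) = 0
  deriv_right : derivWithin h (Set.Icc (-1) 1) 1 = 0
  holder : ∃ C : ℝ, ∀ v ∈ Set.Icc (-1 : ℝ) 1, ∀ w ∈ Set.Icc (-1 : ℝ) 1,
    |iteratedDerivWithin k h (Set.Icc (-1) 1) v - iteratedDerivWithin k h (Set.Icc (-1) 1) w|
      ≤ C * |v - w| ^ δ

/-- The opinion `w' = w - γ P(|w|) (w - v) + η D(|w|)` after an interaction with an agent of
opinion `v`. -/
def postOpinion (P D : ℝ → ℝ) (γ w v η : ℝ) : ℝ :=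
  w - γ * P |w| * (w - v) + η * D |w|

/-- Indicator function of `|x| ≤ 1`. -/
def boundIndicator (x : ℝ) : ℝ :=
  Set.indicator (Set.Icc (-1 : ℝ) 1) (fun _ => 1) x

/-- The weak form `(Q(f, f), φ)` of the interaction operator: the integral of
`χ(|w'| ≤ 1) χ(|w_*'| ≤ 1) (φ(w') - φ(w))` against `f(dw) f(dw_*) Θ(dη) Θ(dη_*)`.
Here `p = ((w, w_*), (η, η_*))`. -/
def collision (P D : ℝ → ℝ) (γ : ℝ) (Θ : Measure ℝ) (f : ProbabilityMeasure Opinion)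
    (φ : ℝ → ℝ) : ℝ :=
  ∫ p : (Opinion × Opinion) × (ℝ × ℝ),
    boundIndicator (postOpinion P D γ p.1.1 p.1.2 p.2.1) *
      boundIndicator (postOpinion P D γ p.1.2 p.1.1 p.2.2) *
      (φ (postOpinion P D γ p.1.1 p.1.2 p.2.1) - φ p.1.1)
    ∂(((f : Measure Opinion).prod (f : Measure Opinion)).prod (Θ.prod Θ))

/-- The Maxwellian case: the diffusion almost surely keeps post-interaction opinions in `[-1, 1]`,
so that the indicator functions in the kernel equal one. -/
def IsMaxwellian (P D : ℝ → ℝ) (γ : ℝ) (Θ : Measure ℝ) : Prop :=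
  ∀ w ∈ Set.Icc (-1 : ℝ) 1, ∀ v ∈ Set.Icc (-1 : ℝ) 1,
    ∀ᵐ η ∂Θ, |postOpinion P D γ w v η| ≤ 1

/-- `f ∈ C¹(ℝ₊, M₀(I))`: a weakly continuous curve of probability measures on `[-1, 1]` whose
pairing with every test function of order `2 + δ` is `C¹` on `[0, ∞)`. -/
structure IsC1Curve (δ : ℝ) (f : ℝ → ProbabilityMeasure Opinion) : Prop where
  continuousOn : ContinuousOn f (Set.Ici 0)
  contDiffOn : ∀ φ : ℝ → ℝ, IsTestFunction 2 δ φ →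
    ContDiffOn ℝ 1 (fun t => ∫ w : Opinion, φ w ∂(f t : Measure Opinion)) (Set.Ici 0)

/-- Weak solutions of the Boltzmann-type opinion equation with initial datum `f₀`. -/
structure IsWeakBoltzmannSolution (P D : ℝ → ℝ) (γ : ℝ) (Θ : Measure ℝ) (δ : ℝ)
    (f₀ : ProbabilityMeasure Opinion) (f : ℝ → ProbabilityMeasure Opinion) : Prop where
  isC1Curve : IsC1Curve δ f
  weak_form : ∀ φ : ℝ → ℝ, IsTestFunction 2 δ φ → ∀ t : ℝ, 0 < t →
    HasDerivAt (fun s => ∫ w : Opinion, φ w ∂(f s : Measure Opinion))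
      (collision P D γ Θ (f t) φ) t
  initial : ∀ φ : ℝ → ℝ, IsTestFunction 2 δ φ →
    Tendsto (fun t => ∫ w : Opinion, φ w ∂(f t : Measure Opinion)) (𝓝[>] 0)
      (𝓝 (∫ w : Opinion, φ w ∂(f₀ : Measure Opinion)))

/-- Weak solutions of `∂_τ g = (λ/2) ∂²_w (D(|w|)² g) + ∂_w ((w - m) g)` with initial datum `g₀`. -/
structure IsWeakFokkerPlanckSolution (D : ℝ → ℝ) (lam m δ : ℝ)
    (g₀ : ProbabilityMeasure Opinion) (g : ℝ → ProbabilityMeasure Opinion) : Prop where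
  isC1Curve : IsC1Curve δ g
  weak_form : ∀ φ : ℝ → ℝ, IsTestFunction 2 δ φ → ∀ τ : ℝ, 0 < τ →
    HasDerivAt (fun s => ∫ w : Opinion, φ w ∂(g s : Measure Opinion))
      (∫ w : Opinion,
        ((m - w) * derivWithin φ (Set.Icc (-1) 1) w +
          lam / 2 * D |(w : ℝ)| ^ 2 * iteratedDerivWithin 2 φ (Set.Icc (-1) 1) w)
        ∂(g τ : Measure Opinion)) τ
  initial : ∀ φ : ℝ → ℝ, IsTestFunction 2 δ φ →
    Tendsto (fun τ => ∫ w : Opinion, φ w ∂(g τ : Measure Opinion)) (𝓝[>] 0)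
      (𝓝 (∫ w : Opinion, φ w ∂(g₀ : Measure Opinion)))

/-- The average opinion. -/
def meanOpinion (f : ProbabilityMeasure Opinion) : ℝ :=
  ∫ w : Opinion, (w : ℝ) ∂(f : Measure Opinion)

/-- The measure puts no mass on the extreme opinions `±1`; true of every measure that has a
density with respect to Lebesgue measure. -/
def NoExtremeMass (f : ProbabilityMeasure Opinion) : Prop :=
  (f : Measure Opinion) {w : Opinion | |(w : ℝ)| = 1} = 0

end

/-! Write `L` for the adjoint operator `(m - w) ∂ + (λ/2) D² ∂²`. A second order Taylor expansion of
`φ(w')` around `w`, averaged over a centred noise of variance `σ² = λγ`, shows that the collision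
term equals `γ (∫ Lφ df + O(γ + σ^δ))`, uniformly in the measure `f` of mean `m`
(`exists_abs_collision_sub_le`). In the time `τ = γt` the rates of change are therefore bounded, so
the rescaled curves are equi-Lipschitz against each test function; compactness gives a limit at all
times (`exists_subseq_tendsto_curve`), and the integrated equation passes to the limit.

The difficulty lies at `±1`. Test functions vanish there together with their first derivatives, so
they see a measure only inside `(-1, 1)`; the total mass and the mean are needed to recover the two
boundary masses (`tendsto_of_tendsto_integral_testFunction`), yet neither `1` nor `w` is a test
function.

The Maxwellian condition resolves this. Since `w'` may not leave the interval even when `w_*` is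
extreme, symmetric noise must satisfy `|η| D(r) ≤ (1 - γ)(1 - r)` with `r = |w|`. First, `|w'| ≤ 1 -
γ + γ|w_*|`, so `w'` is extreme only if `w_*` is; as `w` and `w_*` have the same law, the mass of
the open interval cannot decrease (`IsWeakBoltzmannSolution.noExtremeMass`), and the mean is
conserved by testing with `w (1 - w^(2k))²` and letting `k → ∞`. Second, `D(r)² ≤ c (1 - r)²`: the
diffusion degenerates at `±1` strongly enough that the limit does not charge the boundary either
(`noExtremeMass_of_integral_eq`). -/

/-! ### Regularity and Taylor expansion of test functions -/

namespace IsTestFunction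

variable {δ : ℝ} {φ : ℝ → ℝ}

theorem hasDerivWithinAt (hφ : IsTestFunction 2 δ φ) {x : ℝ} (hx : x ∈ Set.Icc (-1 : ℝ) 1) :
    HasDerivWithinAt φ (derivWithin φ (Set.Icc (-1) 1) x) (Set.Icc (-1) 1) x :=
  ((hφ.contDiffOn.differentiableOn (by norm_num)) x hx).hasDerivWithinAt

theorem contDiffOn_derivWithin (hφ : IsTestFunction 2 δ φ) :
    ContDiffOn ℝ 1 (derivWithin φ (Set.Icc (-1) 1)) (Set.Icc (-1) 1) :=
  hφ.contDiffOn.derivWithin (uniqueDiffOn_Icc (by norm_num)) (by norm_num)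

theorem hasDerivWithinAt_derivWithin (hφ : IsTestFunction 2 δ φ) {x : ℝ}
    (hx : x ∈ Set.Icc (-1 : ℝ) 1) :
    HasDerivWithinAt (derivWithin φ (Set.Icc (-1) 1))
      (iteratedDerivWithin 2 φ (Set.Icc (-1) 1) x) (Set.Icc (-1) 1) x := by
  have h := ((hφ.contDiffOn_derivWithin.differentiableOn (by norm_num)) x hx).hasDerivWithinAt
  rw [iteratedDerivWithin_succ]
  refine h.congr_deriv (derivWithin_congr (fun y _ => ?_) ?_) <;> simp [iteratedDerivWithin_one]

theorem continuous_restrict (hφ : IsTestFunction 2 δ φ) :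
    Continuous fun w : Opinion => φ w :=
  continuousOn_iff_continuous_domRestrict.1 hφ.contDiffOn.continuousOn

theorem continuous_derivWithin (hφ : IsTestFunction 2 δ φ) :
    Continuous fun w : Opinion => derivWithin φ (Set.Icc (-1) 1) w :=
  continuousOn_iff_continuous_domRestrict.1 hφ.contDiffOn_derivWithin.continuousOn

theorem continuous_iteratedDerivWithin (hφ : IsTestFunction 2 δ φ) :
    Continuous fun w : Opinion => iteratedDerivWithin 2 φ (Set.Icc (-1) 1) w :=
  continuousOn_iff_continuous_domRestrict.1 <|
    hφ.contDiffOn.continuousOn_iteratedDerivWithin (by norm_num) (uniqueDiffOn_Icc (by norm_num))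

/-- Second order Taylor formula with Hölder remainder. -/
theorem exists_taylor_bound (hδ : 0 ≤ δ) (hφ : IsTestFunction 2 δ φ) :
    ∃ C : ℝ, 0 ≤ C ∧ ∀ w ∈ Set.Icc (-1 : ℝ) 1, ∀ x ∈ Set.Icc (-1 : ℝ) 1,
      |φ x - φ w - (derivWithin φ (Set.Icc (-1) 1) w * (x - w)
        + 1 / 2 * iteratedDerivWithin 2 φ (Set.Icc (-1) 1) w * (x - w) ^ 2)|
        ≤ C * |x - w| ^ (2 + δ) := by
  obtain ⟨C, hC⟩ := hφ.holder
  refine ⟨max C 0, le_max_right _ _, fun w hw x hx => ?_⟩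
  set r := |x - w| with hr
  set a := derivWithin φ (Set.Icc (-1) 1) w
  set b := iteratedDerivWithin 2 φ (Set.Icc (-1) 1) w
  have hr0 : 0 ≤ r := abs_nonneg _
  have hsub : Set.uIcc w x ⊆ Set.Icc (-1 : ℝ) 1 := Set.uIcc_subset_Icc hw hx
  have hdist : ∀ y ∈ Set.uIcc w x, |y - w| ≤ r := fun y hy => by
    exact Set.abs_sub_left_of_mem_uIcc hy
  -- The mean value inequality is applied twice: the Hölder bound on `φ''` controls the remainder of
  -- `φ'`, which then controls that of `φ`.
  have hder1 : ∀ y ∈ Set.uIcc w x, HasDerivWithinAt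
      (fun y => derivWithin φ (Set.Icc (-1) 1) y - a - b * (y - w))
      (iteratedDerivWithin 2 φ (Set.Icc (-1) 1) y - b) (Set.uIcc w x) y := fun y hy => by
    have h1 := ((hφ.hasDerivWithinAt_derivWithin (hsub hy)).mono hsub).sub_const a
    have h2 := (((hasDerivWithinAt_id y (Set.uIcc w x)).sub_const w).const_mul b)
    exact (h1.sub h2).congr_deriv (by simp)
  have hbound1 : ∀ y ∈ Set.uIcc w x,
      |derivWithin φ (Set.Icc (-1) 1) y - a - b * (y - w)| ≤ max C 0 * r ^ δ * r := fun y hy => by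
    have h := (convex_uIcc w x).norm_image_sub_le_of_norm_hasDerivWithin_le
      (C := max C 0 * r ^ δ) hder1 (fun z hz => ?_) Set.left_mem_uIcc hy
    · have h' : |derivWithin φ (Set.Icc (-1) 1) y - a - b * (y - w)|
          ≤ max C 0 * r ^ δ * |y - w| := by simpa [a] using h
      exact h'.trans (mul_le_mul_of_nonneg_left (hdist y hy) (by positivity))
    · refine (hC z (hsub hz) w hw).trans ?_
      exact mul_le_mul (le_max_left _ _) (Real.rpow_le_rpow (abs_nonneg _) (hdist z hz) hδ)
        (by positivity) (le_max_right _ _)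
  have hder0 : ∀ y ∈ Set.uIcc w x, HasDerivWithinAt
      (fun y => φ y - φ w - (a * (y - w) + 1 / 2 * b * (y - w) ^ 2))
      (derivWithin φ (Set.Icc (-1) 1) y - a - b * (y - w)) (Set.uIcc w x) y := fun y hy => by
    have h1 := ((hφ.hasDerivWithinAt (hsub hy)).mono hsub).sub_const (φ w)
    have h2 := ((hasDerivWithinAt_id y (Set.uIcc w x)).sub_const w)
    refine (h1.sub ((h2.const_mul a).add ((h2.pow 2).const_mul (1 / 2 * b)))).congr_deriv ?_
    simp
    ring
  have h := (convex_uIcc w x).norm_image_sub_le_of_norm_hasDerivWithin_le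
    (C := max C 0 * r ^ δ * r) hder0 hbound1 Set.left_mem_uIcc Set.right_mem_uIcc
  have h' : |φ x - φ w - (a * (x - w) + 1 / 2 * b * (x - w) ^ 2)|
      ≤ max C 0 * r ^ δ * r * r := by simpa using h
  refine h'.trans (le_of_eq ?_)
  rw [Real.rpow_add_of_nonneg hr0 (by norm_num) hδ, Real.rpow_two]
  ring

end IsTestFunction

/-! ### Polynomials with double zeros at the end points -/

namespace Polynomial

theorem derivWithin_Icc (p : ℝ[X]) {x : ℝ} (hx : x ∈ Set.Icc (-1 : ℝ) 1) :
    derivWithin (fun y => p.eval y) (Set.Icc (-1) 1) x = p.derivative.eval x :=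
  (p.hasDerivAt x).hasDerivWithinAt.derivWithin (uniqueDiffOn_Icc (by norm_num) x hx)

theorem iteratedDerivWithin_two_Icc (p : ℝ[X]) {x : ℝ} (hx : x ∈ Set.Icc (-1 : ℝ) 1) :
    iteratedDerivWithin 2 (fun y => p.eval y) (Set.Icc (-1) 1) x
      = p.derivative.derivative.eval x := by
  rw [iteratedDerivWithin_succ, ← p.derivative.derivWithin_Icc hx]
  have h : ∀ y ∈ Set.Icc (-1 : ℝ) 1,
      iteratedDerivWithin 1 (fun y => p.eval y) (Set.Icc (-1) 1) y = p.derivative.eval y :=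
    fun y hy => by rw [iteratedDerivWithin_one, p.derivWithin_Icc hy]
  exact derivWithin_congr h (h x hx)

theorem isTestFunction {δ : ℝ} (hδ : 0 < δ) (hδ_le : δ ≤ 1) (p : ℝ[X]) (h1 : p.eval 1 = 0)
    (h1' : p.eval (-1) = 0) (h2 : p.derivative.eval 1 = 0) (h2' : p.derivative.eval (-1) = 0) :
    IsTestFunction 2 δ fun x => p.eval x where
  contDiffOn := by simpa using (p.contDiff_aeval (𝕜 := ℝ) 2).contDiffOn
  left := h1'
  right := h1
  deriv_left := by rw [p.derivWithin_Icc (by norm_num), h2']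
  deriv_right := by rw [p.derivWithin_Icc (by norm_num), h2]
  holder := by
    set q := p.derivative.derivative with hq
    obtain ⟨K, hK⟩ := isCompact_Icc.exists_bound_of_continuousOn
      (s := Set.Icc (-1 : ℝ) 1) (f := fun x => q.derivative.eval x)
      q.derivative.continuous.continuousOn
    have hK0 : 0 ≤ K := (norm_nonneg _).trans (hK 0 (by norm_num))
    -- With `t = |v - w| / 2 ≤ 1` and `δ ≤ 1` one has `t ≤ t ^ δ`, hence `|v - w| ≤ 2 |v - w| ^ δ`.
    refine ⟨K * 2, fun v hv w hw => ?_⟩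
    rw [p.iteratedDerivWithin_two_Icc hv, p.iteratedDerivWithin_two_Icc hw]
    have h := (convex_Icc (-1 : ℝ) 1).norm_image_sub_le_of_norm_hasDerivWithin_le
      (fun x _ => (q.hasDerivAt x).hasDerivWithinAt) hK hw hv
    rw [Real.norm_eq_abs, Real.norm_eq_abs] at h
    refine h.trans ?_
    rw [mul_assoc]
    refine mul_le_mul_of_nonneg_left ?_ hK0
    have hvw : |v - w| / 2 ≤ 1 := by
      rw [div_le_one (by norm_num), abs_le]; constructor <;> linarith [hv.1, hv.2, hw.1, hw.2]
    have h3 := Real.rpow_le_rpow_of_exponent_ge' (by positivity) hvw hδ.le hδ_le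
    rw [Real.rpow_one, Real.div_rpow (abs_nonneg _) (by norm_num)] at h3
    have h4 : |v - w| ^ δ / 2 ^ δ ≤ |v - w| ^ δ :=
      div_le_self (by positivity) (Real.one_le_rpow (by norm_num) hδ.le)
    linarith

end Polynomial

/-! ### Weak convergence from test functions and the mean -/

theorem Continuous.integrable_of_compactSpace {X : Type*} [TopologicalSpace X] [CompactSpace X]
    [MeasurableSpace X] [OpensMeasurableSpace X] (μ : Measure X) [IsFiniteMeasure μ] {h : X → ℝ}
    (hh : Continuous h) : Integrable h μ :=
  (BoundedContinuousFunction.mkOfCompact ⟨h, hh⟩).integrable μ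

theorem abs_integral_sub_integral_le (μ : ProbabilityMeasure Opinion) (h k : C(Opinion, ℝ)) :
    |∫ w, h w ∂(μ : Measure Opinion) - ∫ w, k w ∂(μ : Measure Opinion)| ≤ dist h k := by
  rw [← integral_sub (h.continuous.integrable_of_compactSpace _)
    (k.continuous.integrable_of_compactSpace _)]
  have := norm_integral_le_of_norm_le_const (μ := (μ : Measure Opinion)) (C := dist h k)
    (f := fun w => h w - k w)
    (Eventually.of_forall fun w => by rw [← dist_eq_norm]; exact ContinuousMap.dist_apply_le_dist w)
  simpa using this

/-- The continuous functions along which a family of probability measures converges. -/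
def convergenceSubmodule {ι : Type*} (F : Filter ι) (μs : ι → ProbabilityMeasure Opinion)
    (μ : ProbabilityMeasure Opinion) : Submodule ℝ C(Opinion, ℝ) where
  carrier := {h | Tendsto (fun i => ∫ w, h w ∂(μs i : Measure Opinion)) F
    (𝓝 (∫ w, h w ∂(μ : Measure Opinion)))}
  add_mem' {h k} hh hk := by
    have H : ∀ ν : ProbabilityMeasure Opinion, ∫ w, (h + k) w ∂(ν : Measure Opinion)
        = ∫ w, h w ∂(ν : Measure Opinion) + ∫ w, k w ∂(ν : Measure Opinion) := fun ν =>
      integral_add (h.continuous.integrable_of_compactSpace _)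
        (k.continuous.integrable_of_compactSpace _)
    simp only [Set.mem_ofPred_eq, H] at hh hk ⊢
    exact hh.add hk
  zero_mem' := by simp [tendsto_const_nhds]
  smul_mem' c h hh := by
    have H : ∀ ν : ProbabilityMeasure Opinion, ∫ w, (c • h) w ∂(ν : Measure Opinion)
        = c * ∫ w, h w ∂(ν : Measure Opinion) := fun ν => integral_const_mul c _
    simp only [Set.mem_ofPred_eq, H] at hh ⊢
    exact hh.const_mul c

/-- Integration against a probability measure is 1-Lipschitz for the uniform norm, with the same
constant along the whole family, so an `ε/3` argument applies. -/
theorem isClosed_convergenceSubmodule {ι : Type*} (F : Filter ι)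
    (μs : ι → ProbabilityMeasure Opinion) (μ : ProbabilityMeasure Opinion) :
    IsClosed (convergenceSubmodule F μs μ : Set C(Opinion, ℝ)) := by
  refine isClosed_of_closure_subset fun h hh => ?_
  refine Metric.tendsto_nhds.2 fun ε hε => ?_
  obtain ⟨k, hk, hhk⟩ := Metric.mem_closure_iff.1 hh (ε / 3) (by positivity)
  filter_upwards [Metric.tendsto_nhds.1 hk (ε / 3) (by positivity)] with i hi
  have h1 := abs_le.1 (abs_integral_sub_integral_le (μs i) h k)
  have h2 := abs_le.1 (abs_integral_sub_integral_le μ h k)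
  rw [Real.dist_eq, abs_lt] at hi ⊢
  constructor <;> linarith [h1.1, h1.2, h2.1, h2.2, hi.1, hi.2]

/-- Each of the first `k` terms of the geometric series is at least `r ^ k`. The bound gives both
the `1/k` approximation of `1 - X ^ 2` and the boundedness of the boundary layer. -/
theorem natCast_mul_pow_mul_one_sub_le {r : ℝ} (h0 : 0 ≤ r) (h1 : r ≤ 1) (k : ℕ) :
    (k : ℝ) * r ^ k * (1 - r) ≤ 1 := by
  have h : (k : ℝ) * r ^ k ≤ ∑ i ∈ Finset.range k, r ^ i := by
    have := Finset.card_nsmul_le_sum (Finset.range k) (fun i => r ^ i) (r ^ k) fun i hi =>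
      pow_le_pow_of_le_one h0 h1 (Finset.mem_range.1 hi).le
    simpa using this
  calc (k : ℝ) * r ^ k * (1 - r) ≤ (∑ i ∈ Finset.range k, r ^ i) * (1 - r) :=
        mul_le_mul_of_nonneg_right h (by linarith)
    _ = 1 - r ^ k := geom_sum_mul_neg r k
    _ ≤ 1 := by linarith [pow_nonneg h0 k]

/-- A polynomial as a continuous function of the opinion. -/
noncomputable def polynomialOnOpinion (p : Polynomial ℝ) : C(Opinion, ℝ) :=
  p.toContinuousMapOn (Set.Icc (-1) 1)

@[simp]
theorem polynomialOnOpinion_apply (p : Polynomial ℝ) (w : Opinion) :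
    polynomialOnOpinion p w = p.eval (w : ℝ) := rfl

/-- Convergence of the mean and of the integrals of all test functions imply weak convergence. -/
theorem tendsto_of_tendsto_integral_testFunction {δ : ℝ} (hδ : 0 < δ) (hδ_le : δ ≤ 1)
    {ι : Type*} {F : Filter ι} {μs : ι → ProbabilityMeasure Opinion}
    {μ : ProbabilityMeasure Opinion}
    (h : ∀ φ, IsTestFunction 2 δ φ → Tendsto (fun i => ∫ w : Opinion, φ w ∂(μs i : Measure Opinion))
      F (𝓝 (∫ w : Opinion, φ w ∂(μ : Measure Opinion))))
    (hmean : Tendsto (fun i => meanOpinion (μs i)) F (𝓝 (meanOpinion μ))) :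
    Tendsto μs F (𝓝 μ) := by
  set S := convergenceSubmodule F μs μ with hS
  have hcl : IsClosed (S : Set C(Opinion, ℝ)) := isClosed_convergenceSubmodule F μs μ
  open Polynomial in
  have hgap : ∀ j, polynomialOnOpinion ((1 - X ^ 2) * X ^ j) ∈ S := fun j => by
    -- `1 - X ^ 2` has only simple zeros at `±1`. The extra factor makes them double, and the error
    -- `w ^ (2k) (1 - w ^ 2)` is at most `1/k` uniformly.
    have hk : ∀ k : ℕ, polynomialOnOpinion ((1 - X ^ 2) * (1 - X ^ (2 * k)) * X ^ j) ∈ S :=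
      fun k => h _ (Polynomial.isTestFunction hδ hδ_le _ (by simp) (by simp) (by simp) (by simp))
    refine hcl.mem_of_tendsto (b := atTop) ?_ (Eventually.of_forall hk)
    rw [tendsto_iff_dist_tendsto_zero]
    have hlim : Tendsto (fun k : ℕ => 1 / (k : ℝ)) atTop (𝓝 0) :=
      tendsto_one_div_atTop_nhds_zero_nat
    refine squeeze_zero' (Eventually.of_forall fun _ => dist_nonneg) ?_ hlim
    filter_upwards [eventually_gt_atTop 0] with k hk0
    have hkpos : (0 : ℝ) < k := by exact_mod_cast hk0
    refine (ContinuousMap.dist_le (by positivity)).2 fun w => ?_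
    have hw2 : (w : ℝ) ^ 2 ≤ 1 := by
      have := abs_le.2 w.2
      rw [← sq_abs]; nlinarith [abs_nonneg (w : ℝ)]
    have hwj : |(w : ℝ)| ^ j ≤ 1 := pow_le_one₀ (abs_nonneg _) (abs_le.2 w.2)
    have hb := natCast_mul_pow_mul_one_sub_le (sq_nonneg (w : ℝ)) hw2 k
    rw [Real.dist_eq, le_div_iff₀ hkpos]
    have : (polynomialOnOpinion ((1 - X ^ 2) * (1 - X ^ (2 * k)) * X ^ j)) w
        - polynomialOnOpinion ((1 - X ^ 2) * X ^ j) w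
        = -((((w : ℝ) ^ 2) ^ k * (1 - (w : ℝ) ^ 2)) * (w : ℝ) ^ j) := by
      simp [pow_mul]; ring
    rw [this, abs_neg, abs_mul, abs_pow (w : ℝ) j,
      abs_of_nonneg (mul_nonneg (by positivity) (by linarith))]
    calc _ ≤ ((w : ℝ) ^ 2) ^ k * (1 - (w : ℝ) ^ 2) * 1 * k := by
          have : 0 ≤ ((w : ℝ) ^ 2) ^ k * (1 - (w : ℝ) ^ 2) :=
            mul_nonneg (by positivity) (by linarith)
          gcongr
      _ ≤ 1 := by linarith
  open Polynomial in
  have hmono : ∀ j, polynomialOnOpinion (X ^ j) ∈ S := by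
    intro j
    induction j using Nat.twoStepInduction with
    | zero =>
      change Tendsto _ _ _
      simp [tendsto_const_nhds]
    | one =>
      change Tendsto _ _ _
      simpa [meanOpinion] using hmean
    | more j ih _ =>
      -- Modulo multiples of `1 - X ^ 2`, every polynomial reduces to degree at most one, where mass
      -- and mean decide.
      have : polynomialOnOpinion (X ^ (j + 2))
          = polynomialOnOpinion (X ^ j) - polynomialOnOpinion ((1 - X ^ 2) * X ^ j) := by
        ext w; simp; ring
      rw [this]
      exact S.sub_mem ih (hgap j)
  have hpoly : ∀ p : Polynomial ℝ, polynomialOnOpinion p ∈ S := fun p => by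
    induction p using Polynomial.induction_on' with
    | add p q hp hq =>
      have : polynomialOnOpinion (p + q) = polynomialOnOpinion p + polynomialOnOpinion q := by
        ext w; simp
      rw [this]; exact S.add_mem hp hq
    | monomial n a =>
      have : polynomialOnOpinion (Polynomial.monomial n a)
          = a • polynomialOnOpinion (Polynomial.X ^ n) := by
        ext w; simp
      rw [this]; exact S.smul_mem a (hmono n)
  refine ProbabilityMeasure.tendsto_iff_forall_integral_tendsto.2 fun k => ?_
  change k.toContinuousMap ∈ S
  refine closure_minimal (s := (polynomialFunctions (Set.Icc (-1 : ℝ) 1) : Set C(Opinion, ℝ)))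
    ?_ hcl (continuousMap_mem_polynomialFunctions_closure (-1) 1 k.toContinuousMap)
  rintro _ ⟨p, -, rfl⟩
  exact hpoly p

/-! ### Compactness for curves of probability measures -/

theorem continuous_meanOpinion : Continuous meanOpinion := by
  refine continuous_iff_continuousAt.2 fun μ => ?_
  exact ProbabilityMeasure.tendsto_iff_forall_integral_tendsto.1 tendsto_id
    (BoundedContinuousFunction.mkOfCompact ⟨fun w : Opinion => (w : ℝ), continuous_subtype_val⟩)

theorem tendsto_integral_of_continuous {ι : Type*} {F : Filter ι}
    {μs : ι → ProbabilityMeasure Opinion} {μ : ProbabilityMeasure Opinion}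
    (hμ : Tendsto μs F (𝓝 μ)) {h : Opinion → ℝ} (hh : Continuous h) :
    Tendsto (fun i => ∫ w, h w ∂(μs i : Measure Opinion)) F
      (𝓝 (∫ w, h w ∂(μ : Measure Opinion))) :=
  ProbabilityMeasure.tendsto_iff_forall_integral_tendsto.1 hμ
    (BoundedContinuousFunction.mkOfCompact ⟨h, hh⟩)

/-- A sequence of curves of probability measures with constant mean which is uniformly Lipschitz
along every test function has a subsequence that converges at all times. -/
theorem exists_subseq_tendsto_curve {δ : ℝ} (hδ : 0 < δ) (hδ_le : δ ≤ 1)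
    {G : ℕ → ℝ → ProbabilityMeasure Opinion} {m : ℝ} (hmean : ∀ n τ, meanOpinion (G n τ) = m)
    (hlip : ∀ φ, IsTestFunction 2 δ φ → ∃ C : ℝ, ∀ n s t,
      |∫ w : Opinion, φ w ∂(G n t : Measure Opinion) - ∫ w : Opinion, φ w ∂(G n s : Measure Opinion)|
        ≤ C * |t - s|) :
    ∃ κ : ℕ → ℕ, StrictMono κ ∧ ∃ g : ℝ → ProbabilityMeasure Opinion,
      ∀ τ, Tendsto (fun k => G (κ k) τ) atTop (𝓝 (g τ)) := by
  -- The countable product is compact and metrizable, so a single subsequence serves all rational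
  -- times.
  obtain ⟨a, κ, hκ, ha⟩ :=
    CompactSpace.tendsto_subseq (X := ℚ → ProbabilityMeasure Opinion) fun n q => G n q
  refine ⟨κ, hκ, ?_⟩
  suffices H : ∀ τ : ℝ, ∃ μ, Tendsto (fun k => G (κ k) τ) atTop (𝓝 μ) by
    choose g hg using H
    exact ⟨g, hg⟩
  intro τ
  -- A further subsequence only supplies the candidate limit; the Cauchy property, obtained by
  -- comparison with a nearby rational time, makes all of `κ` converge to it.
  obtain ⟨μ, ψ, hψ, hμ⟩ := CompactSpace.tendsto_subseq fun k => G (κ k) τ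
  refine ⟨μ, tendsto_of_tendsto_integral_testFunction hδ hδ_le (fun φ hφ => ?_) ?_⟩
  · refine tendsto_nhds_of_cauchySeq_of_subseq ?_ hψ.tendsto_atTop
      (tendsto_integral_of_continuous hμ hφ.continuous_restrict)
    obtain ⟨C, hC⟩ := hlip φ hφ
    have hC0 : 0 ≤ C := by simpa using (abs_nonneg _).trans (hC 0 0 1)
    refine Metric.cauchySeq_iff'.2 fun ε hε => ?_
    -- `C + 1` in place of `C` avoids dividing by zero.
    obtain ⟨q, hq⟩ := exists_rat_near τ (show 0 < ε / (4 * (C + 1)) by positivity)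
    have hq' : C * |τ - q| ≤ ε / 4 := by
      calc C * |τ - q| ≤ (C + 1) * (ε / (4 * (C + 1))) := by gcongr; linarith
        _ = ε / 4 := by field_simp
    have hc := (tendsto_integral_of_continuous (tendsto_pi_nhds.1 ha q)
      hφ.continuous_restrict).cauchySeq
    obtain ⟨N, hN⟩ := Metric.cauchySeq_iff'.1 hc (ε / 4) (by positivity)
    refine ⟨N, fun n hn => ?_⟩
    have h1 := abs_le.1 ((hC (κ n) q τ).trans hq')
    have h2 := abs_le.1 ((hC (κ N) q τ).trans hq')
    have h3 := hN n hn
    rw [Real.dist_eq, abs_lt] at h3 ⊢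
    simp only [Function.comp] at h3
    constructor <;> linarith [h1.1, h1.2, h2.1, h2.2, h3.1, h3.2]
  · have : meanOpinion μ = m := by
      refine tendsto_nhds_unique ((continuous_meanOpinion.tendsto μ).comp hμ) ?_
      simp [Function.comp_def, hmean]
    simp [hmean, this]

/-! ### The collision operator of a Maxwellian kernel -/

/-- The post-interaction opinion as an element of `[-1, 1]`. -/
noncomputable def interactionMap (D : ℝ → ℝ) (γ σ : ℝ) (p : (Opinion × Opinion) × ℝ) : Opinion :=
  Set.projIcc (-1) 1 (by norm_num) (postOpinion (fun _ => 1) D γ p.1.1 p.1.2 (σ * p.2))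

theorem continuous_diffusion {D : ℝ → ℝ} (hD_cont : ContinuousOn D (Set.Icc 0 1)) :
    Continuous fun w : Opinion => D |(w : ℝ)| :=
  hD_cont.comp_continuous (by fun_prop) fun w => ⟨abs_nonneg _, abs_le.2 w.2⟩

theorem continuous_postOpinion {D : ℝ → ℝ} (hD_cont : ContinuousOn D (Set.Icc 0 1)) (γ : ℝ) :
    Continuous fun p : (Opinion × Opinion) × ℝ =>
    postOpinion (fun _ => 1) D γ p.1.1 p.1.2 p.2 := by
  have := (continuous_diffusion hD_cont).comp
    (continuous_fst.comp continuous_fst : Continuous fun p : (Opinion × Opinion) × ℝ => p.1.1)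
  simp only [Function.comp_def] at this
  simp only [postOpinion, mul_one]
  exact Continuous.add (by fun_prop) (continuous_snd.mul this)

theorem continuous_interactionMap {D : ℝ → ℝ} (hD_cont : ContinuousOn D (Set.Icc 0 1))
    (γ σ : ℝ) : Continuous (interactionMap D γ σ) := by
  have h : Continuous fun p : (Opinion × Opinion) × ℝ => (p.1, σ * p.2) := by fun_prop
  exact continuous_projIcc.comp ((continuous_postOpinion hD_cont γ).comp h)

theorem IsMaxwellian.ae_prod
    {D : ℝ → ℝ} (hD_cont : ContinuousOn D (Set.Icc 0 1)) {γ : ℝ} {Θ : Measure ℝ} [SFinite Θ]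
    (hmax : IsMaxwellian (fun _ => 1) D γ Θ) (π : Measure (Opinion × Opinion)) [SFinite π] :
    ∀ᵐ p ∂π.prod Θ, |postOpinion (fun _ => 1) D γ p.1.1 p.1.2 p.2| ≤ 1 := by
  have hm : MeasurableSet {p : (Opinion × Opinion) × ℝ |
      |postOpinion (fun _ => 1) D γ p.1.1 p.1.2 p.2| ≤ 1} :=
    (isClosed_le (continuous_postOpinion hD_cont γ).abs continuous_const).measurableSet
  rw [Measure.ae_prod_iff_ae_ae hm]
  exact Eventually.of_forall fun q => hmax (q.1 : ℝ) q.1.2 (q.2 : ℝ) q.2.2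

/-- Both indicators are almost surely one, and the integrand then no longer involves the second
noise, which integrates out. -/
theorem collision_eq_integral_interactionMap
    {D : ℝ → ℝ} (hD_cont : ContinuousOn D (Set.Icc 0 1)) {γ σ : ℝ} {ν : Measure ℝ}
    [IsProbabilityMeasure ν]
    (hmax : IsMaxwellian (fun _ => 1) D γ (ν.map fun y => σ * y))
    (f : ProbabilityMeasure Opinion) {φ : ℝ → ℝ} (hφ : Measurable fun w : Opinion => φ w) :
    collision (fun _ => 1) D γ (ν.map fun y => σ * y) f φ
      = ∫ p, (φ (interactionMap D γ σ p) - φ p.1.1)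
        ∂(((f : Measure Opinion).prod (f : Measure Opinion)).prod ν) := by
  set Θ := ν.map fun y => σ * y with hΘ
  have hσm : Measurable fun y : ℝ => σ * y := by fun_prop
  have : IsProbabilityMeasure Θ := Measure.isProbabilityMeasure_map hσm.aemeasurable
  set π := (f : Measure Opinion).prod (f : Measure Opinion) with hπ
  have hπm : MeasurePreserving (id : Opinion × Opinion → Opinion × Opinion) π π :=
    MeasurePreserving.id π
  have h1 : MeasurePreserving (Prod.map id Prod.fst) (π.prod (Θ.prod Θ)) (π.prod Θ) :=
    hπm.prod measurePreserving_fst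
  -- The second indicator sees the pair in reverse order with the other noise; the product measure
  -- is invariant under the swap.
  have h2 : MeasurePreserving (Prod.map Prod.swap Prod.snd) (π.prod (Θ.prod Θ)) (π.prod Θ) :=
    MeasurePreserving.prod Measure.measurePreserving_swap measurePreserving_snd
  have h3 : MeasurePreserving (Prod.map id fun y => σ * y) (π.prod ν) (π.prod Θ) :=
    hπm.prod (hσm.measurePreserving ν)
  set H : (Opinion × Opinion) × ℝ → ℝ := fun p =>
    φ (Set.projIcc (-1 : ℝ) 1 (by norm_num) (postOpinion (fun _ => 1) D γ p.1.1 p.1.2 p.2))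
      - φ p.1.1 with hH
  have hHm : Measurable H := by
    refine Measurable.sub (hφ.comp ?_) (hφ.comp (by fun_prop))
    exact (continuous_projIcc.comp (continuous_postOpinion hD_cont γ)).measurable
  have e1 : ∫ p, H (Prod.map id Prod.fst p) ∂π.prod (Θ.prod Θ) = ∫ p, H p ∂π.prod Θ := by
    rw [← h1.map_eq, integral_map h1.measurable.aemeasurable hHm.aestronglyMeasurable]
  have e3 : ∫ p, H (Prod.map id (fun y => σ * y) p) ∂π.prod ν = ∫ p, H p ∂π.prod Θ := by
    rw [← h3.map_eq, integral_map h3.measurable.aemeasurable hHm.aestronglyMeasurable]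
  refine Eq.trans ?_ (e1.trans e3.symm)
  refine integral_congr_ae ?_
  filter_upwards [h1.quasiMeasurePreserving.ae (hmax.ae_prod hD_cont π),
    h2.quasiMeasurePreserving.ae (hmax.ae_prod hD_cont π)] with p hp1 hp2
  have hp1' := abs_le.1 hp1
  have hp2' := abs_le.1 hp2
  simp only [Prod.map, id, Prod.fst_swap, Prod.snd_swap] at hp1' hp2'
  simp only [hH, Prod.map, id, boundIndicator]
  rw [Set.indicator_of_mem (show _ ∈ Set.Icc (-1 : ℝ) 1 from hp1'),
    Set.indicator_of_mem (show _ ∈ Set.Icc (-1 : ℝ) 1 from hp2'),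
    Set.projIcc_of_mem _ (show _ ∈ Set.Icc (-1 : ℝ) 1 from hp1')]
  simp

/-- Almost surely the post-interaction opinion need not be truncated. -/
theorem IsMaxwellian.ae_interactionMap_eq
    {D : ℝ → ℝ} (hD_cont : ContinuousOn D (Set.Icc 0 1)) {γ σ : ℝ} {ν : Measure ℝ}
    [IsProbabilityMeasure ν]
    (hmax : IsMaxwellian (fun _ => 1) D γ (ν.map fun y => σ * y))
    (π : Measure (Opinion × Opinion)) [SFinite π] :
    ∀ᵐ p ∂π.prod ν, (interactionMap D γ σ p : ℝ)
      = p.1.1 + (γ * (p.1.2 - p.1.1) + σ * p.2 * D |(p.1.1 : ℝ)|) := by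
  have hσm : Measurable fun y : ℝ => σ * y := by fun_prop
  have : IsProbabilityMeasure (ν.map fun y => σ * y) :=
    Measure.isProbabilityMeasure_map hσm.aemeasurable
  have h3 : MeasurePreserving (Prod.map id fun y => σ * y) (π.prod ν)
      (π.prod (ν.map fun y => σ * y)) :=
    (MeasurePreserving.id π).prod (hσm.measurePreserving ν)
  filter_upwards [h3.quasiMeasurePreserving.ae (hmax.ae_prod hD_cont π)] with p hp
  have hp' := abs_le.1 hp
  simp only [Prod.map, id] at hp'
  rw [interactionMap, Set.projIcc_of_mem _ (show _ ∈ Set.Icc (-1 : ℝ) 1 from hp')]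
  simp only [postOpinion]
  ring

/-! ### Bounds that the Maxwellian condition forces on the diffusion -/

theorem ae_neg_of_ae {ν : Measure ℝ}
    (hν_symm : ν.map (fun y => -y) = ν) {P : ℝ → Prop}
    (h : ∀ᵐ y ∂ν, P y) : ∀ᵐ y ∂ν, P (-y) := by
  rw [← hν_symm] at h
  exact ae_of_ae_map (by fun_prop) h

/-- Diffusion of a Maxwellian interaction is dominated by the distance to the extreme opinions. -/
theorem IsMaxwellian.ae_abs_mul_diffusion_le {ν : Measure ℝ}
    {D : ℝ → ℝ} {γ σ : ℝ}
    (hD_nonneg : ∀ r ∈ Set.Icc (0 : ℝ) 1, 0 ≤ D r)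
    (hν_symm : ν.map (fun y => -y) = ν)
    (hmax : IsMaxwellian (fun _ => 1) D γ (ν.map fun y => σ * y)) {r : ℝ}
    (hr : r ∈ Set.Icc (0 : ℝ) 1) :
    ∀ᵐ y ∂ν, |σ * y| * D r ≤ (1 - γ) * (1 - r) := by
  -- The partner at `1` leaves the least room above `r`; symmetry of the noise turns the one-sided
  -- bound into one on the absolute value.
  have h := ae_of_ae_map (by fun_prop) (hmax r ⟨by linarith [hr.1], hr.2⟩ 1 (by norm_num))
  filter_upwards [h, ae_neg_of_ae hν_symm h] with y h1 h2
  simp only [postOpinion, abs_of_nonneg hr.1] at h1 h2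
  rw [← abs_of_nonneg (hD_nonneg r hr), ← abs_mul, abs_le]
  constructor <;> nlinarith [(abs_le.1 h1).2, (abs_le.1 h2).2]

/-- The integral of a non-integrable function is `0` by convention, so the value `1` forces
integrability. -/
theorem integrable_sq_of_integral_eq_one {ν : Measure ℝ}
    (hν_var : ∫ y, y ^ 2 ∂ν = 1) :
    Integrable (fun y : ℝ => y ^ 2) ν := by
  by_contra h
  rw [integral_undef h] at hν_var
  norm_num at hν_var

/-- Squaring the almost sure bound and taking expectations removes the noise, whose variance is one.
This quadratic decay of `D ^ 2` at the boundary is what the limit equation retains from the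
Maxwellian condition. -/
theorem IsMaxwellian.sq_mul_diffusion_sq_le {ν : Measure ℝ} [IsProbabilityMeasure ν]
    {D : ℝ → ℝ} {γ σ : ℝ} (hγ : γ ∈ Set.Icc (0 : ℝ) 1)
    (hD_nonneg : ∀ r ∈ Set.Icc (0 : ℝ) 1, 0 ≤ D r)
    (hν_symm : ν.map (fun y => -y) = ν) (hν_var : ∫ y, y ^ 2 ∂ν = 1)
    (hmax : IsMaxwellian (fun _ => 1) D γ (ν.map fun y => σ * y)) {r : ℝ}
    (hr : r ∈ Set.Icc (0 : ℝ) 1) :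
    σ ^ 2 * D r ^ 2 ≤ (1 - r) ^ 2 := by
  have hi := integrable_sq_of_integral_eq_one hν_var
  have h : ∫ y, σ ^ 2 * D r ^ 2 * y ^ 2 ∂ν ≤ ∫ _, (1 - r) ^ 2 ∂ν := by
    refine integral_mono_ae (hi.const_mul _) (integrable_const _) ?_
    filter_upwards [hmax.ae_abs_mul_diffusion_le hD_nonneg hν_symm hr] with y hy
    have h1 : |σ * y| * D r ≤ 1 - r := by nlinarith [hγ.1, hr.2]
    have h0 : 0 ≤ |σ * y| * D r := mul_nonneg (abs_nonneg _) (hD_nonneg r hr)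
    calc σ ^ 2 * D r ^ 2 * y ^ 2 = (|σ * y| * D r) ^ 2 := by rw [mul_pow, sq_abs]; ring
      _ ≤ (1 - r) ^ 2 := pow_le_pow_left₀ h0 h1 2
  rw [integral_const_mul, hν_var] at h
  simpa using h

/-! ### Moments of the noise -/

theorem integral_eq_zero_of_symm {ν : Measure ℝ}
    (hν_symm : ν.map (fun y => -y) = ν) : ∫ y, y ∂ν = 0 := by
  have h : ∫ y, y ∂(ν.map fun y => -y) = ∫ y, -y ∂ν :=
    integral_map (by fun_prop) (by fun_prop)
  rw [hν_symm, integral_neg] at h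
  linarith

theorem integrable_id_of_integrable_sq {ν : Measure ℝ} [IsProbabilityMeasure ν]
    (h : Integrable (fun y : ℝ => y ^ 2) ν) :
    Integrable (fun y : ℝ => y) ν := by
  refine ((integrable_const (1 : ℝ)).add h).mono' (by fun_prop) (Eventually.of_forall fun y => ?_)
  simp only [Pi.add_apply, Real.norm_eq_abs]
  nlinarith [sq_nonneg (|y| - 1), sq_abs y, abs_nonneg y]

/-- Integral of a quadratic polynomial in a centred noise of variance one. -/
theorem integral_quadratic_prod {ν : Measure ℝ} [IsProbabilityMeasure ν]
    (hν_symm : ν.map (fun y => -y) = ν) (hν_var : ∫ y, y ^ 2 ∂ν = 1)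
    {X : Type*} [MeasurableSpace X] {π : Measure X} [SFinite π] {c₀ c₁ c₂ : X → ℝ}
    (h₀ : Integrable c₀ π) (h₁ : Integrable c₁ π) (h₂ : Integrable c₂ π) :
    Integrable (fun p : X × ℝ => c₀ p.1 + c₁ p.1 * p.2 + c₂ p.1 * p.2 ^ 2) (π.prod ν) ∧
    ∫ p : X × ℝ, (c₀ p.1 + c₁ p.1 * p.2 + c₂ p.1 * p.2 ^ 2) ∂π.prod ν
      = ∫ x, c₀ x ∂π + ∫ x, c₂ x ∂π := by
  have hi2 := integrable_sq_of_integral_eq_one hν_var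
  have hi1 := integrable_id_of_integrable_sq hi2
  have i0 : Integrable (fun p : X × ℝ => c₀ p.1) (π.prod ν) := by
    simpa using h₀.mul_prod (integrable_const (1 : ℝ) (μ := ν))
  have i1 : Integrable (fun p : X × ℝ => c₁ p.1 * p.2) (π.prod ν) := h₁.mul_prod hi1
  have i2 : Integrable (fun p : X × ℝ => c₂ p.1 * p.2 ^ 2) (π.prod ν) := h₂.mul_prod hi2
  refine ⟨(i0.add i1).add i2, ?_⟩
  rw [integral_add (f := fun p : X × ℝ => c₀ p.1 + c₁ p.1 * p.2) (i0.add i1) i2,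
    integral_add i0 i1, integral_prod_mul c₁ (fun y => y), integral_prod_mul c₂ (fun y => y ^ 2),
    integral_eq_zero_of_symm hν_symm, hν_var]
  have := integral_prod_mul (μ := π) (ν := ν) c₀ fun _ => (1 : ℝ)
  simp at this
  simp [this]

/-- On a probability space the higher moment dominates the lower one. This makes the Taylor
remainder of order `2 + δ` integrable. -/
theorem integrable_add_abs_rpow {ν : Measure ℝ} [IsProbabilityMeasure ν]
    {α δ c : ℝ} (hδ : 0 < δ) (hδα : δ < α) (hc : 0 ≤ c)
    (hν_moment : Integrable (fun y : ℝ => |y| ^ (2 + α)) ν) :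
    Integrable (fun y : ℝ => (c + |y|) ^ (2 + δ)) ν := by
  have h1 : MemLp (fun y : ℝ => |y|) (ENNReal.ofReal (2 + α)) ν := by
    rw [← integrable_norm_rpow_iff (by fun_prop) (by simp; linarith) (by simp),
      ENNReal.toReal_ofReal (by linarith)]
    simpa using hν_moment
  have h2 : MemLp (fun y : ℝ => c + |y|) (ENNReal.ofReal (2 + α)) ν := (memLp_const c).add h1
  have h3 : MemLp (fun y : ℝ => c + |y|) (ENNReal.ofReal (2 + δ)) ν :=
    h2.mono_exponent (ENNReal.ofReal_le_ofReal (by linarith))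
  have h4 := h3.integrable_norm_rpow (by simp; linarith) (by simp)
  rw [ENNReal.toReal_ofReal (by linarith)] at h4
  refine h4.congr (Eventually.of_forall fun y => ?_)
  simp only [Real.norm_eq_abs]
  rw [abs_of_nonneg (by positivity)]

/-! ### Consistency of the collision operator with the Fokker-Planck operator -/

/-- The formal adjoint of the Fokker-Planck operator. -/
noncomputable def fokkerPlanckAdjoint (D : ℝ → ℝ) (lam m : ℝ) (φ : ℝ → ℝ) (w : ℝ) : ℝ :=
  (m - w) * derivWithin φ (Set.Icc (-1) 1) w +
    lam / 2 * D |w| ^ 2 * iteratedDerivWithin 2 φ (Set.Icc (-1) 1) w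

theorem IsTestFunction.continuous_fokkerPlanckAdjoint {D : ℝ → ℝ}
    (hD_cont : ContinuousOn D (Set.Icc 0 1)) {δ : ℝ} {φ : ℝ → ℝ} (hφ : IsTestFunction 2 δ φ)
    (lam m : ℝ) : Continuous fun w : Opinion => fokkerPlanckAdjoint D lam m φ w := by
  have h1 := hφ.continuous_derivWithin
  have h2 := hφ.continuous_iteratedDerivWithin
  have h3 := continuous_diffusion hD_cont
  unfold fokkerPlanckAdjoint
  exact Continuous.add (Continuous.mul (by fun_prop) h1) ((continuous_const.mul (h3.pow 2)).mul h2)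

theorem Continuous.exists_abs_le_of_compactSpace {X : Type*} [TopologicalSpace X] [CompactSpace X]
    {h : X → ℝ} (hh : Continuous h) : ∃ B : ℝ, 0 ≤ B ∧ ∀ x, |h x| ≤ B := by
  obtain ⟨B, hB⟩ := isCompact_univ.exists_bound_of_continuousOn hh.continuousOn
  exact ⟨max B 0, le_max_right _ _, fun x => (hB x trivial).trans (le_max_left _ _)⟩

theorem abs_integral_le_of_abs_le {X : Type*} [MeasurableSpace X] (μ : Measure X)
    [IsProbabilityMeasure μ] {h : X → ℝ} {B : ℝ} (hB : ∀ x, |h x| ≤ B) : |∫ x, h x ∂μ| ≤ B := by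
  simpa using norm_integral_le_of_norm_le_const (μ := μ) (f := h) (C := B) (Eventually.of_forall hB)

theorem abs_opinion_le (w : Opinion) : |(w : ℝ)| ≤ 1 := abs_le.2 w.2

theorem abs_opinion_sub_le (v w : Opinion) : |(v : ℝ) - w| ≤ 2 := by
  rw [abs_le]; constructor <;> linarith [v.2.1, v.2.2, w.2.1, w.2.2]

/-- The first moment of an interaction pair. -/
theorem integral_mul_sub_prod (f : ProbabilityMeasure Opinion) {a : Opinion → ℝ}
    (ha : Continuous a) :
    ∫ q : Opinion × Opinion, a q.1 * ((q.2 : ℝ) - q.1)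
      ∂((f : Measure Opinion).prod (f : Measure Opinion))
      = ∫ w, a w * (meanOpinion f - w) ∂(f : Measure Opinion) := by
  have hc : Continuous fun q : Opinion × Opinion => a q.1 * ((q.2 : ℝ) - q.1) :=
    (ha.comp continuous_fst).mul (by fun_prop)
  rw [integral_prod _ (hc.integrable_of_compactSpace _)]
  congr 1 with w
  have hi : Integrable (fun v : Opinion => (v : ℝ)) (f : Measure Opinion) :=
    continuous_subtype_val.integrable_of_compactSpace _
  simp only [integral_const_mul]
  rw [integral_sub hi (integrable_const _), meanOpinion]
  simp

/-- Consistency of the collision operator with the Fokker-Planck operator, uniformly in the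
distribution of opinions. -/
theorem exists_abs_collision_sub_le {D : ℝ → ℝ} (hD_cont : ContinuousOn D (Set.Icc 0 1))
    (hD_mem : ∀ r ∈ Set.Icc (0 : ℝ) 1, D r ∈ Set.Icc (0 : ℝ) 1)
    {α δ lam : ℝ} (hδ : 0 < δ) (hδα : δ < α) (hlam : 0 < lam)
    {ν : Measure ℝ} [IsProbabilityMeasure ν] (hν_symm : ν.map (fun y => -y) = ν)
    (hν_var : ∫ y, y ^ 2 ∂ν = 1) (hν_moment : Integrable (fun y : ℝ => |y| ^ (2 + α)) ν)
    {φ : ℝ → ℝ} (hφ : IsTestFunction 2 δ φ) :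
    ∃ A : ℝ, 0 ≤ A ∧ ∀ γ σ : ℝ, γ ∈ Set.Ioo (0 : ℝ) (1 / 2) → 0 < σ → σ ^ 2 = lam * γ →
      IsMaxwellian (fun _ => 1) D γ (ν.map fun y => σ * y) → ∀ f : ProbabilityMeasure Opinion,
      |collision (fun _ => 1) D γ (ν.map fun y => σ * y) f φ
        - γ * ∫ w : Opinion, fokkerPlanckAdjoint D lam (meanOpinion f) φ w ∂(f : Measure Opinion)|
        ≤ γ * (A * (γ + σ ^ δ)) := by
  obtain ⟨C, hC0, hC⟩ := hφ.exists_taylor_bound hδ.le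
  obtain ⟨B, hB0, hB⟩ := hφ.continuous_iteratedDerivWithin.exists_abs_le_of_compactSpace
  obtain ⟨B', -, hB'⟩ := hφ.continuous_restrict.exists_abs_le_of_compactSpace
  -- Chosen so that `2γ ≤ σ c`: here `γ = σ ^ 2 / lam` and `σ ≤ 1 + lam`. The whole displacement is
  -- then at most `σ (c + |y|)`.
  set c := 2 * (1 + lam) / lam with hc
  set K := ∫ y, (c + |y|) ^ (2 + δ) ∂ν with hK
  have hc0 : 0 ≤ c := by positivity
  have hK0 : 0 ≤ K := integral_nonneg fun y => by positivity
  have hKi := integrable_add_abs_rpow hδ hδα hc0 hν_moment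
  refine ⟨2 * B + lam * C * K, by positivity, fun γ σ hγ hσ hσγ hmax f => ?_⟩
  have hγ0 := hγ.1
  set π := (f : Measure Opinion).prod (f : Measure Opinion) with hπ
  set a : Opinion → ℝ := fun w => derivWithin φ (Set.Icc (-1) 1) w with ha_def
  set b : Opinion → ℝ := fun w => iteratedDerivWithin 2 φ (Set.Icc (-1) 1) w with hb_def
  set d : Opinion → ℝ := fun w => D |(w : ℝ)| with hd_def
  have ha : Continuous a := hφ.continuous_derivWithin
  have hb : Continuous b := hφ.continuous_iteratedDerivWithin
  have hd : Continuous d := continuous_diffusion hD_cont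
  -- The coefficients of the second order Taylor polynomial in powers of the noise. The linear one
  -- averages to zero, and `σ ^ 2 = lam * γ` has been used in `c₂`.
  set c₀ : Opinion × Opinion → ℝ := fun q =>
    γ * (a q.1 * ((q.2 : ℝ) - q.1)) + 1 / 2 * γ ^ 2 * (b q.1 * ((q.2 : ℝ) - q.1) ^ 2) with hc₀
  set c₁ : Opinion × Opinion → ℝ := fun q =>
    (a q.1 + b q.1 * (γ * ((q.2 : ℝ) - q.1))) * (σ * d q.1) with hc₁
  set c₂ : Opinion × Opinion → ℝ := fun q => γ * (lam / 2 * d q.1 ^ 2 * b q.1) with hc₂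
  have hi₀ : Integrable c₀ π := Continuous.integrable_of_compactSpace _ (by fun_prop)
  have hi₁ : Integrable c₁ π := Continuous.integrable_of_compactSpace _ (by fun_prop)
  have hi₂ : Integrable c₂ π := Continuous.integrable_of_compactSpace _ (by fun_prop)
  obtain ⟨hqi, hq⟩ := integral_quadratic_prod hν_symm hν_var hi₀ hi₁ hi₂
  have hsplit : ∫ q, c₀ q ∂π + ∫ q, c₂ q ∂π
      = γ * ∫ w : Opinion, fokkerPlanckAdjoint D lam (meanOpinion f) φ w ∂(f : Measure Opinion)
        + 1 / 2 * γ ^ 2 * ∫ q : Opinion × Opinion, b q.1 * ((q.2 : ℝ) - q.1) ^ 2 ∂π := by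
    have e0 : ∫ q, c₀ q ∂π = γ * ∫ w, a w * (meanOpinion f - w) ∂(f : Measure Opinion)
        + 1 / 2 * γ ^ 2 * ∫ q : Opinion × Opinion, b q.1 * ((q.2 : ℝ) - q.1) ^ 2 ∂π := by
      rw [hc₀, integral_add
        (Continuous.integrable_of_compactSpace _ (by fun_prop))
        (Continuous.integrable_of_compactSpace _ (by fun_prop)), integral_const_mul,
        integral_const_mul, hπ, integral_mul_sub_prod f ha]
    have e2 : ∫ q, c₂ q ∂π = γ * ∫ w, lam / 2 * d w ^ 2 * b w ∂(f : Measure Opinion) := by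
      have := integral_fun_fst (μ := (f : Measure Opinion)) (ν := (f : Measure Opinion))
        (fun w => γ * (lam / 2 * d w ^ 2 * b w))
      rw [hc₂, hπ, this, integral_const_mul]
      simp
    have e3 : ∫ w : Opinion, fokkerPlanckAdjoint D lam (meanOpinion f) φ w ∂(f : Measure Opinion)
        = ∫ w, a w * (meanOpinion f - w) ∂(f : Measure Opinion)
          + ∫ w, lam / 2 * d w ^ 2 * b w ∂(f : Measure Opinion) := by
      rw [← integral_add (Continuous.integrable_of_compactSpace _ (by fun_prop))
        (Continuous.integrable_of_compactSpace _ (by fun_prop))]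
      congr 1 with w
      simp only [fokkerPlanckAdjoint, ha_def, hb_def, hd_def]
      ring
    rw [e0, e2, e3]
    ring
  have hsq : |1 / 2 * γ ^ 2 * ∫ q : Opinion × Opinion, b q.1 * ((q.2 : ℝ) - q.1) ^ 2 ∂π|
      ≤ γ * (2 * B * γ) := by
    have h4 : |∫ q : Opinion × Opinion, b q.1 * ((q.2 : ℝ) - q.1) ^ 2 ∂π| ≤ B * 4 := by
      refine abs_integral_le_of_abs_le π fun q => ?_
      rw [abs_mul, abs_pow]
      have : |(q.2 : ℝ) - q.1| ^ 2 ≤ 2 ^ 2 :=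
        pow_le_pow_left₀ (abs_nonneg _) (abs_opinion_sub_le q.2 q.1) 2
      exact mul_le_mul (hB q.1) (by linarith) (by positivity) hB0
    rw [abs_mul, abs_of_nonneg (by positivity)]
    nlinarith [mul_le_mul_of_nonneg_left h4 (sq_nonneg γ)]
  have hrem : |collision (fun _ => 1) D γ (ν.map fun y => σ * y) f φ
      - (∫ q, c₀ q ∂π + ∫ q, c₂ q ∂π)| ≤ C * σ ^ (2 + δ) * K := by
    have hTi : Integrable (fun p => φ (interactionMap D γ σ p) - φ p.1.1) (π.prod ν) := by
      have hcont : Continuous fun p => φ (interactionMap D γ σ p) - φ p.1.1 :=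
        (hφ.continuous_restrict.comp (continuous_interactionMap hD_cont γ σ)).sub
          (hφ.continuous_restrict.comp (by fun_prop))
      refine Integrable.of_bound hcont.aestronglyMeasurable (B' + B')
        (Eventually.of_forall fun p => ?_)
      exact (abs_sub _ _).trans (add_le_add (hB' _) (hB' _))
    rw [collision_eq_integral_interactionMap hD_cont hmax f hφ.continuous_restrict.measurable, ← hq,
      ← integral_sub hTi hqi]
    have hbi : Integrable (fun p : (Opinion × Opinion) × ℝ =>
        C * σ ^ (2 + δ) * (c + |p.2|) ^ (2 + δ)) (π.prod ν) := (hKi.comp_snd π).const_mul _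
    have hbe : ∫ p : (Opinion × Opinion) × ℝ, C * σ ^ (2 + δ) * (c + |p.2|) ^ (2 + δ) ∂π.prod ν
        = C * σ ^ (2 + δ) * K := by
      rw [integral_const_mul]
      have := integral_fun_snd (μ := π) (ν := ν) (fun y : ℝ => (c + |y|) ^ (2 + δ))
      rw [this]
      simp [hK]
    rw [← hbe]
    rw [← Real.norm_eq_abs]
    refine norm_integral_le_of_norm_le hbi ?_
    filter_upwards [hmax.ae_interactionMap_eq hD_cont π] with p hp
    have hT := hC p.1.1 p.1.1.2 _ (interactionMap D γ σ p).2
    rw [hp, add_sub_cancel_left] at hT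
    rw [hp, Real.norm_eq_abs]
    have hD1 : d p.1.1 ∈ Set.Icc (0 : ℝ) 1 := hD_mem |(p.1.1 : ℝ)| ⟨abs_nonneg _, abs_opinion_le _⟩
    have hΔ : |γ * ((p.1.2 : ℝ) - p.1.1) + σ * p.2 * d p.1.1| ≤ σ * (c + |p.2|) := by
      have e1 : |γ * ((p.1.2 : ℝ) - p.1.1)| ≤ γ * 2 := by
        rw [abs_mul, abs_of_pos hγ0]
        exact mul_le_mul_of_nonneg_left (abs_opinion_sub_le _ _) hγ0.le
      have e2 : |σ * p.2 * d p.1.1| ≤ σ * |p.2| := by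
        rw [abs_mul, abs_mul, abs_of_pos hσ, abs_of_nonneg hD1.1]
        exact mul_le_of_le_one_right (by positivity) hD1.2
      have e3 : γ * 2 ≤ σ * c := by
        have hσ1 : σ ≤ 1 + lam := by nlinarith [hγ.2]
        have : σ * c = 2 * (σ * (1 + lam)) / lam := by rw [hc]; ring
        rw [this, le_div_iff₀ hlam]
        nlinarith
      linarith [abs_add_le (γ * ((p.1.2 : ℝ) - p.1.1)) (σ * p.2 * d p.1.1)]
    have hpow := Real.rpow_le_rpow (abs_nonneg _) hΔ (show 0 ≤ 2 + δ by linarith)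
    rw [Real.mul_rpow hσ.le (by positivity)] at hpow
    have hfin := hT.trans (mul_le_mul_of_nonneg_left hpow hC0)
    rw [← mul_assoc] at hfin
    refine le_trans (le_of_eq ?_) hfin
    congr 1
    simp only [hc₀, hc₁, hc₂, ha_def, hb_def, hd_def]
    linear_combination (1 / 2 * D |(p.1.1 : ℝ)| ^ 2
      * iteratedDerivWithin 2 φ (Set.Icc (-1) 1) (p.1.1 : ℝ) * p.2 ^ 2) * hσγ
  -- Two of the powers of `σ` give the factor `γ`; the Hölder exponent supplies the vanishing factor
  -- `σ ^ δ`.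
  have hσpow : C * σ ^ (2 + δ) * K = γ * (lam * C * K * σ ^ δ) := by
    rw [Real.rpow_add hσ, Real.rpow_two, hσγ]; ring
  rw [hsplit, hσpow] at hrem
  have h1 := abs_le.1 hrem
  have h2 := abs_le.1 hsq
  have h3 : γ * ((2 * B + lam * C * K) * (γ + σ ^ δ))
      = γ * (2 * B * γ) + γ * (lam * C * K * σ ^ δ)
        + γ * (2 * B * σ ^ δ + lam * C * K * γ) := by ring
  have h4 : 0 ≤ γ * (2 * B * σ ^ δ + lam * C * K * γ) := by positivity
  rw [h3, abs_le]
  constructor <;> linarith [h1.1, h1.2, h2.1, h2.2]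

/-! ### Integrated Boltzmann equation and limits of test functions -/

theorem integral_eq_sub_of_hasDerivAt_of_abs_le {F Q : ℝ → ℝ} {M : ℝ}
    (hF : ContinuousOn F (Set.Ici 0)) (hQ : ∀ s, 0 < s → HasDerivAt F (Q s) s)
    (hM : ∀ s, |Q s| ≤ M) {t : ℝ} (ht : 0 ≤ t) :
    IntervalIntegrable Q volume 0 t ∧ ∫ s in (0 : ℝ)..t, Q s = F t - F 0 := by
  -- Measurability of `Q` in time comes for free, since `Q` is a derivative for positive times.
  have hm : AEStronglyMeasurable Q (volume.restrict (Set.Ioc 0 t)) := by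
    refine (measurable_deriv F).aestronglyMeasurable.congr ?_
    refine (ae_restrict_iff' measurableSet_Ioc).2 (Eventually.of_forall fun s hs => ?_)
    exact (hQ s hs.1).deriv
  have hi : IntervalIntegrable Q volume 0 t :=
    (intervalIntegrable_iff_integrableOn_Ioc_of_le ht).2
      (Integrable.of_bound hm M (Eventually.of_forall hM))
  exact ⟨hi, intervalIntegral.integral_eq_sub_of_hasDerivAt_of_le ht
    (hF.mono Set.Icc_subset_Ici_self) (fun s hs => hQ s hs.1) hi⟩

theorem IsC1Curve.continuousOn_integral {δ : ℝ} {f : ℝ → ProbabilityMeasure Opinion}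
    (hf : IsC1Curve δ f) {φ : ℝ → ℝ} (hφ : IsTestFunction 2 δ φ) :
    ContinuousOn (fun t => ∫ w : Opinion, φ w ∂(f t : Measure Opinion)) (Set.Ici 0) :=
  (hf.contDiffOn φ hφ).continuousOn

theorem IsWeakBoltzmannSolution.integral_zero {P D : ℝ → ℝ} {γ : ℝ} {Θ : Measure ℝ} {δ : ℝ}
    {f₀ : ProbabilityMeasure Opinion} {f : ℝ → ProbabilityMeasure Opinion}
    (hf : IsWeakBoltzmannSolution P D γ Θ δ f₀ f) {φ : ℝ → ℝ} (hφ : IsTestFunction 2 δ φ) :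
    ∫ w : Opinion, φ w ∂(f 0 : Measure Opinion) = ∫ w : Opinion, φ w ∂(f₀ : Measure Opinion) := by
  refine tendsto_nhds_unique ?_ (hf.initial φ hφ)
  exact ((hf.isC1Curve.continuousOn_integral hφ) 0 Set.self_mem_Ici).mono_left
    (nhdsWithin_mono _ Set.Ioi_subset_Ici_self)

theorem abs_collision_le {D : ℝ → ℝ} (hD_cont : ContinuousOn D (Set.Icc 0 1)) {γ σ : ℝ}
    {ν : Measure ℝ} [IsProbabilityMeasure ν]
    (hmax : IsMaxwellian (fun _ => 1) D γ (ν.map fun y => σ * y))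
    (f : ProbabilityMeasure Opinion) {φ : ℝ → ℝ} (hφ : Measurable fun w : Opinion => φ w) {B : ℝ}
    (hB : ∀ w : Opinion, |φ w| ≤ B) :
    |collision (fun _ => 1) D γ (ν.map fun y => σ * y) f φ| ≤ B + B := by
  rw [collision_eq_integral_interactionMap hD_cont hmax f hφ]
  exact abs_integral_le_of_abs_le _ fun p => (abs_sub _ _).trans (add_le_add (hB _) (hB _))

/-- The weak formulation extends to bounded pointwise limits of test functions. -/
theorem IsWeakBoltzmannSolution.integral_sub_eq_of_tendsto {D : ℝ → ℝ}
    (hD_cont : ContinuousOn D (Set.Icc 0 1)) {γ σ : ℝ} {ν : Measure ℝ} [IsProbabilityMeasure ν]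
    (hmax : IsMaxwellian (fun _ => 1) D γ (ν.map fun y => σ * y)) {δ : ℝ}
    {f₀ : ProbabilityMeasure Opinion} {f : ℝ → ProbabilityMeasure Opinion}
    (hf : IsWeakBoltzmannSolution (fun _ => 1) D γ (ν.map fun y => σ * y) δ f₀ f)
    {φ : ℕ → ℝ → ℝ} (hφ : ∀ k, IsTestFunction 2 δ (φ k)) {B : ℝ}
    (hB : ∀ k, ∀ w : Opinion, |φ k w| ≤ B) {ψ : ℝ → ℝ}
    (hψ : ∀ w : Opinion, Tendsto (fun k => φ k w) atTop (𝓝 (ψ w))) {t : ℝ} (ht : 0 ≤ t) :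
    ∫ w : Opinion, ψ w ∂(f t : Measure Opinion) - ∫ w : Opinion, ψ w ∂(f₀ : Measure Opinion)
      = ∫ s in (0 : ℝ)..t, ∫ p, (ψ (interactionMap D γ σ p) - ψ p.1.1)
        ∂(((f s : Measure Opinion).prod (f s : Measure Opinion)).prod ν) := by
  have hlim : ∀ μ : ProbabilityMeasure Opinion,
      Tendsto (fun k => ∫ w : Opinion, φ k w ∂(μ : Measure Opinion)) atTop
        (𝓝 (∫ w : Opinion, ψ w ∂(μ : Measure Opinion))) := fun μ =>
    tendsto_integral_of_dominated_convergence (fun _ => B)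
      (fun k => (hφ k).continuous_restrict.aestronglyMeasurable) (integrable_const _)
      (fun k => Eventually.of_forall (hB k)) (Eventually.of_forall hψ)
  have hFTC : ∀ k, IntervalIntegrable
      (fun s => collision (fun _ => 1) D γ (ν.map fun y => σ * y) (f s) (φ k)) volume 0 t ∧ _ :=
    fun k => integral_eq_sub_of_hasDerivAt_of_abs_le
      (hf.isC1Curve.continuousOn_integral (hφ k)) (hf.weak_form _ (hφ k))
      (fun s => abs_collision_le hD_cont hmax (f s) (hφ k).continuous_restrict.measurable (hB k)) ht
  refine tendsto_nhds_unique ((hlim (f t)).sub (hlim f₀)) ?_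
  have heq : ∀ k, ∫ w : Opinion, φ k w ∂(f t : Measure Opinion)
      - ∫ w : Opinion, φ k w ∂(f₀ : Measure Opinion)
      = ∫ s in (0 : ℝ)..t, collision (fun _ => 1) D γ (ν.map fun y => σ * y) (f s) (φ k) :=
    fun k => by rw [(hFTC k).2, hf.integral_zero (hφ k)]
  simp only [heq]
  refine intervalIntegral.tendsto_integral_filter_of_dominated_convergence (fun _ => B + B)
    (Eventually.of_forall fun k => by
      rw [Set.uIoc_of_le ht]; exact (hFTC k).1.1.aestronglyMeasurable)
    (Eventually.of_forall fun k => Eventually.of_forall fun s _ =>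
      abs_collision_le hD_cont hmax (f s) (hφ k).continuous_restrict.measurable (hB k))
    intervalIntegrable_const (Eventually.of_forall fun s _ => ?_)
  simp only [fun k => collision_eq_integral_interactionMap hD_cont hmax (f s)
    (hφ k).continuous_restrict.measurable]
  refine tendsto_integral_of_dominated_convergence (fun _ => B + B) (fun k => ?_)
    (integrable_const _) (fun k => Eventually.of_forall fun p =>
      (abs_sub _ _).trans (add_le_add (hB k _) (hB k _)))
    (Eventually.of_forall fun p => (hψ _).sub (hψ _))
  exact (((hφ k).continuous_restrict.comp (continuous_interactionMap hD_cont γ σ)).sub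
    ((hφ k).continuous_restrict.comp (by fun_prop))).aestronglyMeasurable

/-! ### Boundary mass and mean of Boltzmann solutions -/

open Polynomial in
/-- Test polynomials increasing to the indicator function of the open interval. -/
noncomputable def cutoffPolynomial (k : ℕ) : ℝ[X] := (1 - X ^ (2 * k)) ^ 2

/-- Indicator function of the non-extreme opinions. -/
noncomputable def nonExtreme (w : ℝ) : ℝ := if |w| = 1 then 0 else 1

theorem cutoffPolynomial_isTestFunction {δ : ℝ} (hδ : 0 < δ) (hδ_le : δ ≤ 1) (k : ℕ) :
    IsTestFunction 2 δ fun x => (cutoffPolynomial k).eval x := by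
  refine Polynomial.isTestFunction hδ hδ_le _ ?_ ?_ ?_ ?_ <;>
    simp [cutoffPolynomial, Polynomial.derivative_pow]

theorem X_mul_cutoffPolynomial_isTestFunction {δ : ℝ} (hδ : 0 < δ) (hδ_le : δ ≤ 1) (k : ℕ) :
    IsTestFunction 2 δ fun x => (Polynomial.X * cutoffPolynomial k).eval x := by
  refine Polynomial.isTestFunction hδ hδ_le _ ?_ ?_ ?_ ?_ <;>
    simp [cutoffPolynomial, Polynomial.derivative_pow]

theorem cutoffPolynomial_eval (k : ℕ) (x : ℝ) :
    (cutoffPolynomial k).eval x = (1 - x ^ (2 * k)) ^ 2 := by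
  simp [cutoffPolynomial]

theorem abs_cutoffPolynomial_le (k : ℕ) (w : Opinion) :
    |(cutoffPolynomial k).eval (w : ℝ)| ≤ 1 := by
  have h1 : ((w : ℝ) ^ 2) ^ k ≤ 1 :=
    pow_le_one₀ (sq_nonneg _) ((sq_le_one_iff_abs_le_one _).2 (abs_opinion_le w))
  have h0 : 0 ≤ ((w : ℝ) ^ 2) ^ k := by positivity
  rw [cutoffPolynomial_eval, abs_of_nonneg (sq_nonneg _), pow_mul]
  exact pow_le_one₀ (by linarith) (by linarith)

theorem tendsto_cutoffPolynomial (w : Opinion) :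
    Tendsto (fun k => (cutoffPolynomial k).eval (w : ℝ)) atTop (𝓝 (nonExtreme w)) := by
  simp only [cutoffPolynomial_eval, nonExtreme, pow_mul]
  split_ifs with h
  · have : (w : ℝ) ^ 2 = 1 := by rw [← sq_abs, h, one_pow]
    simp [this]
  · have h2 : (w : ℝ) ^ 2 < 1 :=
      (sq_lt_one_iff_abs_lt_one _).2 (lt_of_le_of_ne (abs_opinion_le w) h)
    simpa using ((tendsto_pow_atTop_nhds_zero_of_lt_one (sq_nonneg _) h2).const_sub 1).pow 2

theorem measurable_nonExtreme : Measurable nonExtreme :=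
  Measurable.ite (measurableSet_eq_fun (by fun_prop) (by fun_prop)) measurable_const
    measurable_const

theorem nonExtreme_nonneg (w : ℝ) : 0 ≤ nonExtreme w := by
  unfold nonExtreme; split_ifs <;> norm_num

theorem nonExtreme_le_one (w : ℝ) : nonExtreme w ≤ 1 := by
  unfold nonExtreme; split_ifs <;> norm_num

theorem integrable_nonExtreme_comp {X : Type*} [MeasurableSpace X] (μ : Measure X)
    [IsFiniteMeasure μ] {u : X → ℝ} (hu : Measurable u) :
    Integrable (fun x => nonExtreme (u x)) μ :=
  Integrable.of_bound (measurable_nonExtreme.comp hu).aestronglyMeasurable 1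
    (Eventually.of_forall fun x => by
      rw [Real.norm_eq_abs, abs_of_nonneg (nonExtreme_nonneg _)]; exact nonExtreme_le_one _)

theorem noExtremeMass_iff_ae {f : ProbabilityMeasure Opinion} :
    NoExtremeMass f ↔ ∀ᵐ w : Opinion ∂(f : Measure Opinion), |(w : ℝ)| ≠ 1 := by
  rw [NoExtremeMass, ae_iff]
  simp

theorem NoExtremeMass.integral_nonExtreme {f : ProbabilityMeasure Opinion} (hf : NoExtremeMass f) :
    ∫ w : Opinion, nonExtreme w ∂(f : Measure Opinion) = 1 := by
  have : (fun w : Opinion => nonExtreme w) =ᵐ[(f : Measure Opinion)] fun _ => 1 := by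
    filter_upwards [noExtremeMass_iff_ae.1 hf] with w hw
    simp [nonExtreme, hw]
  rw [integral_congr_ae this]
  simp

theorem noExtremeMass_of_one_le_integral {f : ProbabilityMeasure Opinion}
    (hf : 1 ≤ ∫ w : Opinion, nonExtreme w ∂(f : Measure Opinion)) : NoExtremeMass f := by
  have hi := integrable_nonExtreme_comp (f : Measure Opinion) (u := fun w : Opinion => (w : ℝ))
    (by fun_prop)
  have h0 : ∫ w : Opinion, (1 - nonExtreme w) ∂(f : Measure Opinion) = 0 := by
    refine le_antisymm ?_ (integral_nonneg fun w => sub_nonneg.2 (nonExtreme_le_one _))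
    rw [integral_sub (integrable_const _) hi]
    simpa using hf
  rw [integral_eq_zero_iff_of_nonneg (fun w => sub_nonneg.2 (nonExtreme_le_one _))
    ((integrable_const _).sub hi)] at h0
  refine noExtremeMass_iff_ae.2 ?_
  filter_upwards [h0] with w hw h
  simp [nonExtreme, h] at hw

/-- An extreme opinion can only result from an interaction with an extreme opinion. -/
theorem IsMaxwellian.ae_nonExtreme_le {D : ℝ → ℝ} (hD_cont : ContinuousOn D (Set.Icc 0 1))
    (hD_nonneg : ∀ r ∈ Set.Icc (0 : ℝ) 1, 0 ≤ D r) {γ σ : ℝ} (hγ : γ ∈ Set.Ioo (0 : ℝ) 1)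
    {ν : Measure ℝ} [IsProbabilityMeasure ν] (hν_symm : ν.map (fun y => -y) = ν)
    (hmax : IsMaxwellian (fun _ => 1) D γ (ν.map fun y => σ * y))
    (π : Measure (Opinion × Opinion)) [SFinite π] :
    ∀ᵐ p ∂π.prod ν, nonExtreme (p.1.2 : ℝ) ≤ nonExtreme (interactionMap D γ σ p) := by
  have hb : ∀ᵐ p ∂π.prod ν, |σ * p.2| * D |(p.1.1 : ℝ)| ≤ (1 - γ) * (1 - |(p.1.1 : ℝ)|) := by
    have hd := (continuous_diffusion hD_cont).comp
      (continuous_fst.comp continuous_fst : Continuous fun p : (Opinion × Opinion) × ℝ => p.1.1)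
    have hm : MeasurableSet {p : (Opinion × Opinion) × ℝ |
        |σ * p.2| * D |(p.1.1 : ℝ)| ≤ (1 - γ) * (1 - |(p.1.1 : ℝ)|)} :=
      (isClosed_le (Continuous.mul (by fun_prop) hd) (by fun_prop)).measurableSet
    rw [Measure.ae_prod_iff_ae_ae hm]
    exact Eventually.of_forall fun q => hmax.ae_abs_mul_diffusion_le hD_nonneg hν_symm
      (r := |(q.1 : ℝ)|) ⟨abs_nonneg _, abs_opinion_le _⟩
  filter_upwards [hb, hmax.ae_interactionMap_eq hD_cont π] with p hp hT
  by_cases hv : |(p.1.2 : ℝ)| = 1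
  · simpa [nonExtreme, hv] using nonExtreme_nonneg (interactionMap D γ σ p)
  · have hv' := lt_of_le_of_ne (abs_opinion_le p.1.2) hv
    -- The noise bound gives `|w'| ≤ (1 - γ)|w| + γ|w_*| + (1 - γ)(1 - |w|) = 1 - γ + γ|w_*|`.
    have hlt : |(interactionMap D γ σ p : ℝ)| < 1 := by
      have e : (interactionMap D γ σ p : ℝ)
          = (1 - γ) * p.1.1 + γ * p.1.2 + σ * p.2 * D |(p.1.1 : ℝ)| := by rw [hT]; ring
      have hD0 := hD_nonneg |(p.1.1 : ℝ)| ⟨abs_nonneg _, abs_opinion_le _⟩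
      rw [e]
      refine (abs_add_three _ _ _).trans_lt ?_
      rw [abs_mul, abs_mul γ, abs_mul (σ * p.2), abs_of_pos hγ.1, abs_of_nonneg hD0,
        abs_of_nonneg (by linarith [hγ.2] : 0 ≤ 1 - γ)]
      nlinarith [mul_lt_mul_of_pos_left hv' hγ.1]
    simp [nonExtreme, hlt.ne, hv]

/-- In the limit of the cutoffs, the gain is at least the interior mass seen through `w_*` and the
loss is the interior mass seen through `w`. The two masses agree, so the interior mass never drops
below its initial value one. -/
theorem IsWeakBoltzmannSolution.noExtremeMass {D : ℝ → ℝ}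
    (hD_cont : ContinuousOn D (Set.Icc 0 1)) (hD_nonneg : ∀ r ∈ Set.Icc (0 : ℝ) 1, 0 ≤ D r)
    {γ σ : ℝ} (hγ : γ ∈ Set.Ioo (0 : ℝ) 1) {ν : Measure ℝ} [IsProbabilityMeasure ν]
    (hν_symm : ν.map (fun y => -y) = ν)
    (hmax : IsMaxwellian (fun _ => 1) D γ (ν.map fun y => σ * y)) {δ : ℝ} (hδ : 0 < δ)
    (hδ_le : δ ≤ 1) {f₀ : ProbabilityMeasure Opinion} (hf₀ : NoExtremeMass f₀)
    {f : ℝ → ProbabilityMeasure Opinion}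
    (hf : IsWeakBoltzmannSolution (fun _ => 1) D γ (ν.map fun y => σ * y) δ f₀ f)
    {t : ℝ} (ht : 0 ≤ t) : NoExtremeMass (f t) := by
  have h := hf.integral_sub_eq_of_tendsto hD_cont hmax
    (cutoffPolynomial_isTestFunction hδ hδ_le) abs_cutoffPolynomial_le tendsto_cutoffPolynomial ht
  rw [hf₀.integral_nonExtreme] at h
  refine noExtremeMass_of_one_le_integral (sub_nonneg.1 ?_)
  rw [h]
  refine intervalIntegral.integral_nonneg ht fun s _ => ?_
  set π := (f s : Measure Opinion).prod (f s : Measure Opinion) with hπ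
  have hT : Measurable fun p => (interactionMap D γ σ p : ℝ) :=
    measurable_subtype_coe.comp (continuous_interactionMap hD_cont γ σ).measurable
  have i1 := integrable_nonExtreme_comp (π.prod ν) hT
  have i2 := integrable_nonExtreme_comp (π.prod ν)
    (u := fun p => (p.1.1 : ℝ)) (by fun_prop)
  have i3 := integrable_nonExtreme_comp (π.prod ν)
    (u := fun p => (p.1.2 : ℝ)) (by fun_prop)
  have e2 := integral_fun_fst (μ := π) (ν := ν) fun q => nonExtreme (q.1 : ℝ)
  have e3 := integral_fun_fst (μ := π) (ν := ν) fun q => nonExtreme (q.2 : ℝ)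
  have e2' := integral_fun_fst (μ := (f s : Measure Opinion)) (ν := (f s : Measure Opinion))
    fun w => nonExtreme (w : ℝ)
  have e3' := integral_fun_snd (μ := (f s : Measure Opinion)) (ν := (f s : Measure Opinion))
    fun w => nonExtreme (w : ℝ)
  have hmono := integral_mono_ae i3 i1 (hmax.ae_nonExtreme_le hD_cont hD_nonneg hγ hν_symm π)
  rw [integral_sub i1 i2, sub_nonneg]
  refine le_trans (le_of_eq ?_) hmono
  rw [e2, e3, hπ, e2', e3']

/-- The limit of the test functions `w (1 - w^(2k))²` is `w` off the extreme points, which carry no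
mass before or after an interaction. What remains is the average of `γ (w_* - w) + σ y D(|w|)`, zero
by exchange of `w` and `w_*` and by symmetry of the noise. -/
theorem IsWeakBoltzmannSolution.meanOpinion_eq {D : ℝ → ℝ}
    (hD_cont : ContinuousOn D (Set.Icc 0 1)) (hD_nonneg : ∀ r ∈ Set.Icc (0 : ℝ) 1, 0 ≤ D r)
    {γ σ : ℝ} (hγ : γ ∈ Set.Ioo (0 : ℝ) 1) {ν : Measure ℝ} [IsProbabilityMeasure ν]
    (hν_symm : ν.map (fun y => -y) = ν) (hν_var : ∫ y, y ^ 2 ∂ν = 1)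
    (hmax : IsMaxwellian (fun _ => 1) D γ (ν.map fun y => σ * y)) {δ : ℝ} (hδ : 0 < δ)
    (hδ_le : δ ≤ 1) {f₀ : ProbabilityMeasure Opinion} (hf₀ : NoExtremeMass f₀)
    {f : ℝ → ProbabilityMeasure Opinion}
    (hf : IsWeakBoltzmannSolution (fun _ => 1) D γ (ν.map fun y => σ * y) δ f₀ f)
    {t : ℝ} (ht : 0 ≤ t) : meanOpinion (f t) = meanOpinion f₀ := by
  have hB : ∀ k, ∀ w : Opinion, |(Polynomial.X * cutoffPolynomial k).eval (w : ℝ)| ≤ 1 :=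
    fun k w => by
      rw [Polynomial.eval_mul, Polynomial.eval_X, abs_mul]
      exact mul_le_one₀ (abs_opinion_le w) (abs_nonneg _) (abs_cutoffPolynomial_le k w)
  have hψ : ∀ w : Opinion, Tendsto (fun k => (Polynomial.X * cutoffPolynomial k).eval (w : ℝ))
      atTop (𝓝 ((fun x : ℝ => x * nonExtreme x) w)) := fun w => by
    simpa using (tendsto_cutoffPolynomial w).const_mul (w : ℝ)
  have h := hf.integral_sub_eq_of_tendsto hD_cont hmax
    (X_mul_cutoffPolynomial_isTestFunction hδ hδ_le) hB (ψ := fun x => x * nonExtreme x) hψ ht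
  have hmean : ∀ {μ : ProbabilityMeasure Opinion}, NoExtremeMass μ →
      ∫ w : Opinion, (w : ℝ) * nonExtreme w ∂(μ : Measure Opinion) = meanOpinion μ := fun hμ => by
    refine integral_congr_ae ?_
    filter_upwards [noExtremeMass_iff_ae.1 hμ] with w hw
    simp [nonExtreme, hw]
  have hmass : ∀ s, 0 ≤ s → NoExtremeMass (f s) := fun s hs =>
    hf.noExtremeMass hD_cont hD_nonneg hγ hν_symm hmax hδ hδ_le hf₀ hs
  simp only [hmean (hmass t ht), hmean hf₀] at h
  refine sub_eq_zero.1 (h.trans ?_)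
  rw [intervalIntegral.integral_congr (g := fun _ => (0 : ℝ))]
  · simp
  intro s hs
  rw [Set.uIcc_of_le ht] at hs
  set π := (f s : Measure Opinion).prod (f s : Measure Opinion) with hπ
  have hs' := noExtremeMass_iff_ae.1 (hmass s hs.1)
  have hw : ∀ᵐ p ∂π.prod ν, |(p.1.1 : ℝ)| ≠ 1 :=
    (Measure.quasiMeasurePreserving_fst.comp Measure.quasiMeasurePreserving_fst).ae hs'
  have hv : ∀ᵐ p ∂π.prod ν, |(p.1.2 : ℝ)| ≠ 1 :=
    (Measure.quasiMeasurePreserving_snd.comp Measure.quasiMeasurePreserving_fst).ae hs'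
  have hd := continuous_diffusion hD_cont
  have hquad := (integral_quadratic_prod hν_symm hν_var (π := π)
    (c₀ := fun q => γ * (1 * ((q.2 : ℝ) - q.1))) (c₁ := fun q => σ * D |(q.1 : ℝ)|)
    (c₂ := fun _ => 0)
    (Continuous.integrable_of_compactSpace _ (by fun_prop))
    (Continuous.integrable_of_compactSpace _ (continuous_const.mul (hd.comp continuous_fst)))
    (Continuous.integrable_of_compactSpace _ (by fun_prop))).2
  have hzero : ∫ w : Opinion, (1 : ℝ) * (meanOpinion (f s) - w) ∂(f s : Measure Opinion) = 0 := by
    simp only [one_mul]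
    rw [integral_sub (integrable_const _)
      (continuous_subtype_val.integrable_of_compactSpace _), meanOpinion]
    simp
  rw [integral_const_mul, hπ, integral_mul_sub_prod (f s) continuous_const, hzero] at hquad
  refine Eq.trans (integral_congr_ae ?_) (hquad.trans (by simp))
  filter_upwards [hw, hv, hmax.ae_interactionMap_eq hD_cont π,
    hmax.ae_nonExtreme_le hD_cont hD_nonneg hγ hν_symm π] with p hpw hpv hT hle
  have h1 : nonExtreme (p.1.1 : ℝ) = 1 := by simp [nonExtreme, hpw]
  have h2 : nonExtreme (p.1.2 : ℝ) = 1 := by simp [nonExtreme, hpv]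
  have h3 : nonExtreme (interactionMap D γ σ p) = 1 :=
    le_antisymm (nonExtreme_le_one _) (h2.symm.le.trans hle)
  simp only [h1, h3, mul_one]
  rw [hT]
  ring

/-! ### From the integrated to the weak Fokker-Planck equation -/

theorem continuous_integral_curve {g : ℝ → ProbabilityMeasure Opinion} (hg : Continuous g)
    {h : Opinion → ℝ} (hh : Continuous h) :
    Continuous fun s => ∫ w, h w ∂(g s : Measure Opinion) :=
  continuous_iff_continuousAt.2 fun s => tendsto_integral_of_continuous (hg.tendsto s) hh

/-- Solutions of the integrated weak formulation are weak solutions. -/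
theorem isWeakFokkerPlanckSolution_of_integral_eq {D : ℝ → ℝ}
    (hD_cont : ContinuousOn D (Set.Icc 0 1)) {lam m δ : ℝ} {g₀ : ProbabilityMeasure Opinion}
    {g : ℝ → ProbabilityMeasure Opinion} (hg : Continuous g)
    (heq : ∀ φ, IsTestFunction 2 δ φ → ∀ t, 0 ≤ t →
      ∫ w : Opinion, φ w ∂(g t : Measure Opinion) = ∫ w : Opinion, φ w ∂(g₀ : Measure Opinion)
        + ∫ s in (0 : ℝ)..t, ∫ w : Opinion, fokkerPlanckAdjoint D lam m φ w
          ∂(g s : Measure Opinion)) :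
    IsWeakFokkerPlanckSolution D lam m δ g₀ g := by
  have hcont : ∀ φ, IsTestFunction 2 δ φ → Continuous fun s =>
      ∫ w : Opinion, fokkerPlanckAdjoint D lam m φ w ∂(g s : Measure Opinion) := fun φ hφ =>
    continuous_integral_curve hg (hφ.continuous_fokkerPlanckAdjoint hD_cont lam m)
  have hder : ∀ φ (hφ : IsTestFunction 2 δ φ) (t : ℝ), HasDerivAt
      (fun t => ∫ w : Opinion, φ w ∂(g₀ : Measure Opinion) + ∫ s in (0 : ℝ)..t,
        ∫ w : Opinion, fokkerPlanckAdjoint D lam m φ w ∂(g s : Measure Opinion))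
      (∫ w : Opinion, fokkerPlanckAdjoint D lam m φ w ∂(g t : Measure Opinion)) t := fun φ hφ t =>
    (intervalIntegral.integral_hasDerivAt_right ((hcont φ hφ).intervalIntegrable _ _)
      ((hcont φ hφ).stronglyMeasurableAtFilter _ _) (hcont φ hφ).continuousAt).const_add _
  refine ⟨⟨hg.continuousOn, fun φ hφ => ?_⟩, fun φ hφ τ hτ => ?_, fun φ hφ => ?_⟩
  -- The right side of `heq` is C¹ on the whole line, although it equals the pairing only for
  -- nonnegative times.
  · refine ContDiffOn.congr (ContDiff.contDiffOn ?_) fun t ht => heq φ hφ t ht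
    refine contDiff_one_iff_deriv.2 ⟨fun t => (hder φ hφ t).differentiableAt, ?_⟩
    rw [show deriv _ = _ from funext fun t => (hder φ hφ t).deriv]
    exact hcont φ hφ
  · refine (hder φ hφ τ).congr_of_eventuallyEq ?_
    filter_upwards [lt_mem_nhds hτ] with t ht using heq φ hφ t ht.le
  · have h := (continuous_integral_curve hg hφ.continuous_restrict).tendsto 0
    rw [heq φ hφ 0 le_rfl, intervalIntegral.integral_same, add_zero] at h
    exact h.mono_left nhdsWithin_le_nhds

/-! ### Boundary mass of the Fokker-Planck limit -/

/-- Size of the boundary layer of the cutoff polynomials. -/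
noncomputable def boundaryLayer (k : ℕ) (w : ℝ) : ℝ := (k + 1) * |w| ^ k * (1 - |w|)

theorem boundaryLayer_nonneg (k : ℕ) (w : Opinion) : 0 ≤ boundaryLayer k w :=
  mul_nonneg (by positivity) (sub_nonneg.2 (abs_opinion_le w))

theorem boundaryLayer_le (k : ℕ) (w : Opinion) : boundaryLayer k w ≤ 2 := by
  have h1 := natCast_mul_pow_mul_one_sub_le (abs_nonneg (w : ℝ)) (abs_opinion_le w) k
  have h2 : |(w : ℝ)| ^ k ≤ 1 := pow_le_one₀ (abs_nonneg _) (abs_opinion_le w)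
  have h3 : |(w : ℝ)| ^ k * (1 - |(w : ℝ)|) ≤ 1 :=
    mul_le_one₀ h2 (sub_nonneg.2 (abs_opinion_le w)) (by linarith [abs_nonneg (w : ℝ)])
  unfold boundaryLayer
  linarith

theorem continuous_boundaryLayer (k : ℕ) : Continuous fun w : Opinion => boundaryLayer k w := by
  unfold boundaryLayer
  fun_prop

theorem tendsto_boundaryLayer (w : Opinion) :
    Tendsto (fun k => boundaryLayer k w) atTop (𝓝 0) := by
  rcases (abs_opinion_le w).eq_or_lt with h | h
  · simp [boundaryLayer, h]
  · have h1 := tendsto_self_mul_const_pow_of_lt_one (abs_nonneg _) h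
    have h2 := tendsto_pow_atTop_nhds_zero_of_lt_one (abs_nonneg _) h
    have h3 := (h1.add h2).mul_const (1 - |(w : ℝ)|)
    rw [add_zero, zero_mul] at h3
    refine h3.congr fun k => ?_
    unfold boundaryLayer
    ring

/-- Since `|m| ≤ 1`, the outward drift near `±1` is at most of order `1 - |w|`, and the factor `(1 -
r) ^ 2` in the bound on `D ^ 2` absorbs the growth `k ^ 2` of the second derivative. The lower bound
is uniformly bounded and tends to zero pointwise, also at `±1`. -/
theorem neg_boundaryLayer_le_fokkerPlanckAdjoint {D : ℝ → ℝ} {lam m c : ℝ} (hlam : 0 ≤ lam)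
    (hm : |m| ≤ 1) (hD : ∀ r ∈ Set.Icc (0 : ℝ) 1, D r ^ 2 ≤ c * (1 - r) ^ 2)
    (k : ℕ) (w : Opinion) :
    -(4 * boundaryLayer k w + 4 * lam * c * boundaryLayer k w ^ 2)
      ≤ fokkerPlanckAdjoint D lam m (fun x => (cutoffPolynomial (k + 1)).eval x) w := by
  set r := |(w : ℝ)| with hr
  have hr0 : 0 ≤ r := abs_nonneg _
  have hr1 : r ≤ 1 := abs_opinion_le w
  set y := (w : ℝ) ^ (2 * k) with hy
  have hyr : y = (r ^ k) ^ 2 := by rw [hy, hr, ← pow_mul, mul_comm k, pow_mul, pow_mul, sq_abs]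
  have hrk0 : 0 ≤ r ^ k := by positivity
  have hrk1 : r ^ k ≤ 1 := pow_le_one₀ hr0 hr1
  have hw2 : (w : ℝ) ^ 2 = r ^ 2 := (sq_abs _).symm
  set z := 1 - y * (w : ℝ) ^ 2 with hz
  have hz1 : z ≤ 1 := by rw [hz, hyr]; nlinarith [sq_nonneg (r ^ k * w)]
  have hz0 : 0 ≤ z := by
    have : r ^ k * r ≤ 1 := mul_le_one₀ hrk1 hr0 hr1
    rw [hz, hyr, hw2]
    nlinarith [mul_nonneg hrk0 hr0]
  -- The successor form yields the exponents of the derivatives without truncated subtraction.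
  have hexp : 2 * (k + 1) = 2 * k + 1 + 1 := by ring
  have e1 : (cutoffPolynomial (k + 1)).derivative.eval (w : ℝ) = -(4 * (k + 1) * (y * w) * z) := by
    rw [cutoffPolynomial, hexp]
    simp [Polynomial.derivative_pow, hz, hy]
    ring
  have e2 : (cutoffPolynomial (k + 1)).derivative.derivative.eval (w : ℝ)
      = -(4 * (k + 1) * (2 * k + 1) * y * z) + 8 * (k + 1) ^ 2 * (y * w) ^ 2 := by
    rw [cutoffPolynomial, hexp]
    simp [Polynomial.derivative_pow, hz, hy]
    ring
  rw [fokkerPlanckAdjoint, Polynomial.derivWithin_Icc _ w.2,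
    Polynomial.iteratedDerivWithin_two_Icc _ w.2, e1, e2]
  have hk0 : (0 : ℝ) ≤ k := Nat.cast_nonneg k
  have hv : boundaryLayer k w = (k + 1) * r ^ k * (1 - r) := rfl
  have drift : -(4 * boundaryLayer k w) ≤ (m - w) * -(4 * (k + 1) * (y * w) * z) := by
    have hmw : m * w ≤ r := by
      calc m * w ≤ |m * w| := le_abs_self _
        _ = |m| * r := abs_mul _ _
        _ ≤ 1 * r := mul_le_mul_of_nonneg_right hm hr0
        _ = r := one_mul r
    have h1 : -(1 - r) ≤ (w : ℝ) ^ 2 - m * w := by rw [hw2]; nlinarith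
    have h2 : y * z ≤ r ^ k := by
      calc y * z ≤ y * 1 := mul_le_mul_of_nonneg_left hz1 (by rw [hyr]; positivity)
        _ ≤ r ^ k := by rw [hyr]; nlinarith
    have hyz : 0 ≤ y * z := mul_nonneg (by rw [hyr]; positivity) hz0
    have h3 : -(r ^ k * (1 - r)) ≤ y * z * ((w : ℝ) ^ 2 - m * w) := by
      have := mul_le_mul_of_nonneg_left h1 hyz
      nlinarith [mul_le_mul_of_nonneg_right h2 (sub_nonneg.2 hr1)]
    have h4 := mul_le_mul_of_nonneg_left h3 (show (0 : ℝ) ≤ 4 * (k + 1) by positivity)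
    rw [hv]
    linarith
  have diffusion : -(4 * lam * c * boundaryLayer k w ^ 2) ≤ lam / 2 * D r ^ 2
      * (-(4 * (k + 1) * (2 * k + 1) * y * z) + 8 * (k + 1) ^ 2 * (y * w) ^ 2) := by
    have hDr := hD r ⟨hr0, hr1⟩
    -- The nonnegative square is dropped, and `2k + 1 ≤ 2(k + 1)`, `z ≤ 1` bound the rest.
    have h1 : -(8 * (k + 1) ^ 2 * y)
        ≤ -(4 * (k + 1) * (2 * k + 1) * y * z) + 8 * (k + 1) ^ 2 * (y * w) ^ 2 := by
      have hy0 : 0 ≤ y := by rw [hyr]; positivity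
      have hyz : y * z ≤ y := mul_le_of_le_one_right hy0 hz1
      have h2 : 4 * ((k : ℝ) + 1) * (2 * k + 1) * (y * z) ≤ 4 * (k + 1) * (2 * k + 1) * y :=
        mul_le_mul_of_nonneg_left hyz (by positivity)
      have h3 : 0 ≤ 8 * ((k : ℝ) + 1) ^ 2 * (y * w) ^ 2 := by positivity
      have h4 : 0 ≤ 4 * ((k : ℝ) + 1) * y := by positivity
      nlinarith
    have h2 := mul_le_mul_of_nonneg_left h1 (show 0 ≤ lam / 2 * D r ^ 2 by positivity)
    have h3 : lam / 2 * D r ^ 2 * (8 * (k + 1) ^ 2 * y)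
        ≤ lam / 2 * (c * (1 - r) ^ 2) * (8 * (k + 1) ^ 2 * y) := by
      have hy0 : 0 ≤ y := by rw [hyr]; positivity
      gcongr
    have h4 : lam / 2 * (c * (1 - r) ^ 2) * (8 * (k + 1) ^ 2 * y)
        = 4 * lam * c * boundaryLayer k w ^ 2 := by rw [hv, hyr]; ring
    linarith
  linarith

/-- The Fokker-Planck evolution does not charge the extreme opinions. -/
theorem noExtremeMass_of_integral_eq {D : ℝ → ℝ} (hD_cont : ContinuousOn D (Set.Icc 0 1))
    {lam m c δ : ℝ} (hδ : 0 < δ) (hδ_le : δ ≤ 1) (hlam : 0 ≤ lam)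
    (hm : |m| ≤ 1) (hc : 0 ≤ c) (hD : ∀ r ∈ Set.Icc (0 : ℝ) 1, D r ^ 2 ≤ c * (1 - r) ^ 2)
    {g₀ : ProbabilityMeasure Opinion} (hg₀ : NoExtremeMass g₀)
    {g : ℝ → ProbabilityMeasure Opinion} (hg : Continuous g)
    (heq : ∀ φ, IsTestFunction 2 δ φ → ∀ t, 0 ≤ t →
      ∫ w : Opinion, φ w ∂(g t : Measure Opinion) = ∫ w : Opinion, φ w ∂(g₀ : Measure Opinion)
        + ∫ s in (0 : ℝ)..t, ∫ w : Opinion, fokkerPlanckAdjoint D lam m φ w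
          ∂(g s : Measure Opinion))
    {t : ℝ} (ht : 0 ≤ t) : NoExtremeMass (g t) := by
  set e : ℕ → Opinion → ℝ := fun k w =>
    4 * boundaryLayer k w + 4 * lam * c * boundaryLayer k w ^ 2 with he
  set M : ℝ := 4 * 2 + 4 * lam * c * 2 ^ 2 with hM
  have he_cont : ∀ k, Continuous (e k) := fun k => by
    have := continuous_boundaryLayer k
    fun_prop
  have he_bound : ∀ k w, |e k w| ≤ M := fun k w => by
    have h0 := boundaryLayer_nonneg k w
    have h1 := boundaryLayer_le k w
    rw [abs_of_nonneg (by positivity)]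
    simp only [he, hM]
    gcongr
  have he_lim : ∀ w, Tendsto (fun k => e k w) atTop (𝓝 0) := fun w => by
    have h := tendsto_boundaryLayer w
    simpa using (h.const_mul 4).add ((h.pow 2).const_mul (4 * lam * c))
  have hint : Tendsto (fun k => ∫ s in (0 : ℝ)..t, ∫ w, e k w ∂(g s : Measure Opinion)) atTop
      (𝓝 (∫ _ in (0 : ℝ)..t, 0)) := by
    refine intervalIntegral.tendsto_integral_filter_of_dominated_convergence (fun _ => M)
      (Eventually.of_forall fun k =>
        (continuous_integral_curve hg (he_cont k)).aestronglyMeasurable)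
      (Eventually.of_forall fun k => Eventually.of_forall fun s _ =>
        abs_integral_le_of_abs_le _ (he_bound k))
      intervalIntegrable_const (Eventually.of_forall fun s _ => ?_)
    have := tendsto_integral_of_dominated_convergence (μ := (g s : Measure Opinion)) (f := fun _ => 0)
      (fun _ => M) (fun k => (he_cont k).aestronglyMeasurable) (integrable_const _)
      (fun k => Eventually.of_forall (he_bound k)) (Eventually.of_forall he_lim)
    simpa using this
  have hcut : ∀ μ : ProbabilityMeasure Opinion,
      Tendsto (fun k => ∫ w : Opinion, (cutoffPolynomial (k + 1)).eval (w : ℝ) ∂(μ : Measure Opinion))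
        atTop (𝓝 (∫ w : Opinion, nonExtreme w ∂(μ : Measure Opinion))) := fun μ =>
    tendsto_integral_of_dominated_convergence (fun _ => 1)
      (fun k => (cutoffPolynomial_isTestFunction hδ hδ_le _).continuous_restrict.aestronglyMeasurable)
      (integrable_const _) (fun k => Eventually.of_forall (abs_cutoffPolynomial_le _))
      (Eventually.of_forall fun w => (tendsto_cutoffPolynomial w).comp (tendsto_add_atTop_nat 1))
  refine noExtremeMass_of_one_le_integral ?_
  refine hg₀.integral_nonExtreme.symm.le.trans ?_
  -- The cutoff mass at time `t` is at least the initial one minus the time integral of `e k`, which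
  -- vanishes as `k → ∞`.
  have hlow := (hcut g₀).sub hint
  simp only [intervalIntegral.integral_zero, sub_zero] at hlow
  refine le_of_tendsto_of_tendsto' hlow (hcut (g t)) fun k => ?_
  have hφ := cutoffPolynomial_isTestFunction hδ hδ_le (k + 1)
  rw [heq _ hφ t ht, sub_eq_add_neg, ← intervalIntegral.integral_neg]
  refine add_le_add_right (intervalIntegral.integral_mono_on ht ?_ ?_ fun s _ => ?_) _
  · exact (continuous_integral_curve hg (he_cont k)).neg.intervalIntegrable _ _
  · exact (continuous_integral_curve hg
      (hφ.continuous_fokkerPlanckAdjoint hD_cont lam m)).intervalIntegrable _ _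
  · rw [← integral_neg]
    exact integral_mono ((he_cont k).neg.integrable_of_compactSpace _)
      ((hφ.continuous_fokkerPlanckAdjoint hD_cont lam m).integrable_of_compactSpace _)
      fun w => neg_boundaryLayer_le_fokkerPlanckAdjoint hlam hm hD k w

/-! ### The Boltzmann equation in the slow time scale -/

theorem abs_meanOpinion_le (f : ProbabilityMeasure Opinion) : |meanOpinion f| ≤ 1 :=
  abs_integral_le_of_abs_le _ abs_opinion_le

/-- Integrated weak formulation of the Boltzmann equation in the slow time scale. -/
theorem IsWeakBoltzmannSolution.rescaled_integral_eq {D : ℝ → ℝ}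
    (hD_cont : ContinuousOn D (Set.Icc 0 1)) {γ σ : ℝ} (hγ : 0 < γ) {ν : Measure ℝ}
    [IsProbabilityMeasure ν] (hmax : IsMaxwellian (fun _ => 1) D γ (ν.map fun y => σ * y)) {δ : ℝ}
    {f₀ : ProbabilityMeasure Opinion} {f : ℝ → ProbabilityMeasure Opinion}
    (hf : IsWeakBoltzmannSolution (fun _ => 1) D γ (ν.map fun y => σ * y) δ f₀ f)
    {φ : ℝ → ℝ} (hφ : IsTestFunction 2 δ φ) {t : ℝ} (ht : 0 ≤ t) :
    IntervalIntegrable (fun s =>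
      collision (fun _ => 1) D γ (ν.map fun y => σ * y) (f (max s 0 / γ)) φ / γ) volume 0 t ∧
    ∫ s in (0 : ℝ)..t, collision (fun _ => 1) D γ (ν.map fun y => σ * y) (f (max s 0 / γ)) φ / γ
      = ∫ w : Opinion, φ w ∂(f (max t 0 / γ) : Measure Opinion)
        - ∫ w : Opinion, φ w ∂(f₀ : Measure Opinion) := by
  obtain ⟨B, -, hB⟩ := hφ.continuous_restrict.exists_abs_le_of_compactSpace
  have h := integral_eq_sub_of_hasDerivAt_of_abs_le
    (F := fun s => ∫ w : Opinion, φ w ∂(f (max s 0 / γ) : Measure Opinion))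
    (Q := fun s => collision (fun _ => 1) D γ (ν.map fun y => σ * y) (f (max s 0 / γ)) φ / γ)
    (M := (B + B) / γ) ?_ (fun s hs => ?_) (fun s => ?_) ht
  · simpa [hf.integral_zero hφ] using h
  · refine (hf.isC1Curve.continuousOn_integral hφ).comp (by fun_prop) fun s _ => ?_
    exact div_nonneg (le_max_right _ _) hγ.le
  · have hd := (hf.weak_form φ hφ (s / γ) (div_pos hs hγ)).comp s ((hasDerivAt_id s).div_const γ)
    rw [max_eq_left hs.le]
    refine (hd.congr_of_eventuallyEq ?_).congr_deriv (by ring)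
    filter_upwards [lt_mem_nhds hs] with r hr
    simp [max_eq_left hr.le]
  · rw [abs_div, abs_of_pos hγ]
    exact div_le_div_of_nonneg_right (abs_collision_le hD_cont hmax _
      hφ.continuous_restrict.measurable hB) hγ.le

/-- The integrals of the rescaled curve against a test function are Lipschitz. -/
theorem IsWeakBoltzmannSolution.rescaled_lipschitz {D : ℝ → ℝ}
    (hD_cont : ContinuousOn D (Set.Icc 0 1)) {γ σ : ℝ} (hγ : 0 < γ) {ν : Measure ℝ}
    [IsProbabilityMeasure ν] (hmax : IsMaxwellian (fun _ => 1) D γ (ν.map fun y => σ * y)) {δ : ℝ}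
    {f₀ : ProbabilityMeasure Opinion} {f : ℝ → ProbabilityMeasure Opinion}
    (hf : IsWeakBoltzmannSolution (fun _ => 1) D γ (ν.map fun y => σ * y) δ f₀ f)
    {φ : ℝ → ℝ} (hφ : IsTestFunction 2 δ φ) {M : ℝ}
    (hM : ∀ s : ℝ,
      |collision (fun _ => 1) D γ (ν.map fun y => σ * y) (f (max s 0 / γ)) φ / γ| ≤ M)
    (s t : ℝ) :
    |∫ w : Opinion, φ w ∂(f (max t 0 / γ) : Measure Opinion)
      - ∫ w : Opinion, φ w ∂(f (max s 0 / γ) : Measure Opinion)| ≤ M * |t - s| := by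
  have hM0 : 0 ≤ M := (abs_nonneg _).trans (hM 0)
  obtain ⟨his, hs⟩ := hf.rescaled_integral_eq hD_cont hγ hmax hφ (le_max_right s 0)
  obtain ⟨hit, ht⟩ := hf.rescaled_integral_eq hD_cont hγ hmax hφ (le_max_right t 0)
  rw [max_eq_left (le_max_right s 0)] at hs
  rw [max_eq_left (le_max_right t 0)] at ht
  have hsub := intervalIntegral.integral_interval_sub_left hit his
  rw [hs, ht] at hsub
  have hb := intervalIntegral.norm_integral_le_of_norm_le_const (a := max s 0) (b := max t 0)
    (f := fun r => collision (fun _ => 1) D γ (ν.map fun y => σ * y) (f (max r 0 / γ)) φ / γ)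
    fun r _ => hM r
  rw [← hsub, Real.norm_eq_abs, sub_sub_sub_cancel_right] at hb
  exact hb.trans (mul_le_mul_of_nonneg_left (abs_max_sub_max_le_abs t s 0) hM0)

/-! ### Passage to the limit -/

theorem theorem1
    (D : ℝ → ℝ) (hD_cont : ContinuousOn D (Set.Icc 0 1)) (hD_anti : AntitoneOn D (Set.Icc 0 1))
    (hD_mem : ∀ r ∈ Set.Icc (0 : ℝ) 1, D r ∈ Set.Icc (0 : ℝ) 1)
    (α δ lam : ℝ) (hδ_pos : 0 < δ) (hδ_le : δ ≤ 1) (hδα : δ < α) (hlam : 0 < lam)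
    -- the law of `Y`
    (ν : Measure ℝ) [IsProbabilityMeasure ν]
    (hν_symm : ν.map (fun y => -y) = ν)
    (hν_var : ∫ y, y ^ 2 ∂ν = 1)
    (hν_moment : Integrable (fun y : ℝ => |y| ^ (2 + α)) ν)
    (f₀ : ProbabilityMeasure Opinion) (hf₀ : NoExtremeMass f₀)
    (γ σ : ℕ → ℝ) (hγ : ∀ n, γ n ∈ Set.Ioo (0 : ℝ) (1 / 2))
    (hγ_lim : Tendsto γ atTop (𝓝 0))
    (hσ : ∀ n, 0 < σ n) (hσγ : ∀ n, σ n ^ 2 = lam * γ n)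
    (hmax : ∀ n, IsMaxwellian (fun _ => 1) D (γ n) (ν.map (fun y => σ n * y)))
    (f : ℕ → ℝ → ProbabilityMeasure Opinion)
    (hf : ∀ n, IsWeakBoltzmannSolution (fun _ => 1) D (γ n) (ν.map (fun y => σ n * y)) δ f₀ (f n)) :
    ∃ κ : ℕ → ℕ, StrictMono κ ∧ ∃ g : ℝ → ProbabilityMeasure Opinion,
      (∀ τ : ℝ, 0 ≤ τ →
        Tendsto (fun k => f (κ k) (τ / γ (κ k))) atTop (𝓝 (g τ))) ∧
      (∀ τ : ℝ, 0 ≤ τ → NoExtremeMass (g τ)) ∧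
      IsWeakFokkerPlanckSolution D lam (meanOpinion f₀) δ f₀ g ∧
      (∀ τ : ℝ, 0 ≤ τ → meanOpinion (g τ) = meanOpinion f₀) := by
  have hD_nonneg : ∀ r ∈ Set.Icc (0 : ℝ) 1, 0 ≤ D r := fun r hr => (hD_mem r hr).1
  have hγ1 : ∀ n, γ n ∈ Set.Ioo (0 : ℝ) 1 := fun n => ⟨(hγ n).1, by linarith [(hγ n).2]⟩
  set m := meanOpinion f₀ with hm
  -- Freezing the curves at negative times makes the mean and Lipschitz statements valid on the
  -- whole line, so the limit is continuous there as well.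
  set G : ℕ → ℝ → ProbabilityMeasure Opinion := fun n τ => f n (max τ 0 / γ n) with hG
  have hGmean : ∀ n τ, meanOpinion (G n τ) = m := fun n τ =>
    (hf n).meanOpinion_eq hD_cont hD_nonneg (hγ1 n) hν_symm hν_var (hmax n) hδ_pos hδ_le hf₀
      (div_nonneg (le_max_right _ _) (hγ1 n).1.le)
  set Q : (ℝ → ℝ) → ℕ → ℝ → ℝ := fun φ n s =>
    collision (fun _ => 1) D (γ n) (ν.map fun y => σ n * y) (G n s) φ / γ n with hQ
  have hσ_lim : Tendsto (fun n => σ n ^ δ) atTop (𝓝 0) := by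
    have h1 : Tendsto (fun n => Real.sqrt (lam * γ n)) atTop (𝓝 0) := by
      simpa using (hγ_lim.const_mul lam).sqrt
    have h2 : ∀ n, Real.sqrt (lam * γ n) = σ n := fun n => by
      rw [← hσγ n, Real.sqrt_sq (hσ n).le]
    simp only [h2] at h1
    simpa [Real.zero_rpow hδ_pos.ne'] using h1.rpow_const (Or.inr hδ_pos.le)
  have hQ_near : ∀ φ, IsTestFunction 2 δ φ → ∃ ε : ℕ → ℝ, Tendsto ε atTop (𝓝 0) ∧ ∀ n s,
      |Q φ n s - ∫ w : Opinion, fokkerPlanckAdjoint D lam m φ w ∂(G n s : Measure Opinion)| ≤ ε n := by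
    intro φ hφ
    obtain ⟨A, -, hA⟩ := exists_abs_collision_sub_le hD_cont hD_mem hδ_pos hδα hlam hν_symm hν_var
      hν_moment hφ
    refine ⟨fun n => A * (γ n + σ n ^ δ), by simpa using (hγ_lim.add hσ_lim).const_mul A,
      fun n s => ?_⟩
    have h := hA (γ n) (σ n) (hγ n) (hσ n) (hσγ n) (hmax n) (G n s)
    have hγn := (hγ1 n).1
    -- Conservation of the mean turns the nonlinear drift towards `meanOpinion (G n s)` into the
    -- fixed drift towards `m`.
    rw [hGmean] at h
    have e : Q φ n s - ∫ w : Opinion, fokkerPlanckAdjoint D lam m φ w ∂(G n s : Measure Opinion)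
        = (collision (fun _ => 1) D (γ n) (ν.map fun y => σ n * y) (G n s) φ
          - γ n * ∫ w : Opinion, fokkerPlanckAdjoint D lam m φ w ∂(G n s : Measure Opinion)) / γ n := by
      simp only [hQ]
      field_simp
    rw [e, abs_div, abs_of_pos hγn, div_le_iff₀ hγn, mul_comm _ (γ n)]
    exact h
  have hQ_bound : ∀ φ, IsTestFunction 2 δ φ → ∃ M : ℝ, ∀ n s, |Q φ n s| ≤ M := by
    intro φ hφ
    obtain ⟨ε, hε, hQε⟩ := hQ_near φ hφ
    obtain ⟨E, hE⟩ := hε.bddAbove_range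
    obtain ⟨B, -, hB⟩ :=
      (hφ.continuous_fokkerPlanckAdjoint hD_cont lam m).exists_abs_le_of_compactSpace
    refine ⟨E + B, fun n s => ?_⟩
    have h1 := (hQε n s).trans (hE (Set.mem_range_self n))
    have h2 := abs_integral_le_of_abs_le (G n s : Measure Opinion) hB
    have h3 := abs_add_le (Q φ n s - ∫ w : Opinion, fokkerPlanckAdjoint D lam m φ w
      ∂(G n s : Measure Opinion))
      (∫ w : Opinion, fokkerPlanckAdjoint D lam m φ w ∂(G n s : Measure Opinion))
    rw [sub_add_cancel] at h3
    linarith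
  have hlip : ∀ φ, IsTestFunction 2 δ φ → ∃ C : ℝ, ∀ n s t,
      |∫ w : Opinion, φ w ∂(G n t : Measure Opinion)
        - ∫ w : Opinion, φ w ∂(G n s : Measure Opinion)| ≤ C * |t - s| := fun φ hφ => by
    obtain ⟨M, hM⟩ := hQ_bound φ hφ
    exact ⟨M, fun n s t => (hf n).rescaled_lipschitz hD_cont (hγ1 n).1 (hmax n) hφ (hM n) s t⟩
  obtain ⟨κ, hκ, g, hg⟩ := exists_subseq_tendsto_curve hδ_pos hδ_le hGmean hlip
  have hgmean : ∀ τ, meanOpinion (g τ) = m := fun τ => by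
    refine tendsto_nhds_unique ((continuous_meanOpinion.tendsto _).comp (hg τ)) ?_
    simp [Function.comp_def, hGmean]
  have hg_cont : Continuous g := by
    refine continuous_iff_continuousAt.2 fun τ =>
      tendsto_of_tendsto_integral_testFunction hδ_pos hδ_le (fun φ hφ => ?_) ?_
    · obtain ⟨C, hC⟩ := hlip φ hφ
      have hC' : ∀ t, |∫ w : Opinion, φ w ∂(g t : Measure Opinion)
          - ∫ w : Opinion, φ w ∂(g τ : Measure Opinion)| ≤ C * |t - τ| := fun t =>
        le_of_tendsto ((tendsto_integral_of_continuous (hg t) hφ.continuous_restrict).sub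
          (tendsto_integral_of_continuous (hg τ) hφ.continuous_restrict)).abs
          (Eventually.of_forall fun k => hC (κ k) τ t)
      refine tendsto_iff_dist_tendsto_zero.2 (squeeze_zero (fun _ => dist_nonneg) hC' ?_)
      have : Continuous fun t : ℝ => C * |t - τ| := by fun_prop
      simpa using this.tendsto τ
    · simp [hgmean]
  have heq : ∀ φ, IsTestFunction 2 δ φ → ∀ t, 0 ≤ t →
      ∫ w : Opinion, φ w ∂(g t : Measure Opinion) = ∫ w : Opinion, φ w ∂(f₀ : Measure Opinion)
        + ∫ s in (0 : ℝ)..t, ∫ w : Opinion, fokkerPlanckAdjoint D lam m φ w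
          ∂(g s : Measure Opinion) := by
    intro φ hφ t ht
    obtain ⟨ε, hε, hQε⟩ := hQ_near φ hφ
    obtain ⟨M, hM⟩ := hQ_bound φ hφ
    have hint : ∀ n, IntervalIntegrable (Q φ n) volume 0 t ∧ ∫ s in (0 : ℝ)..t, Q φ n s
        = ∫ w : Opinion, φ w ∂(G n t : Measure Opinion)
          - ∫ w : Opinion, φ w ∂(f₀ : Measure Opinion) := fun n =>
      (hf n).rescaled_integral_eq hD_cont (hγ1 n).1 (hmax n) hφ ht
    have hlim : Tendsto (fun k => ∫ s in (0 : ℝ)..t, Q φ (κ k) s) atTop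
        (𝓝 (∫ s in (0 : ℝ)..t, ∫ w : Opinion, fokkerPlanckAdjoint D lam m φ w
          ∂(g s : Measure Opinion))) := by
      refine intervalIntegral.tendsto_integral_filter_of_dominated_convergence (fun _ => M)
        (Eventually.of_forall fun k => by
          rw [Set.uIoc_of_le ht]; exact (hint (κ k)).1.1.aestronglyMeasurable)
        (Eventually.of_forall fun k => Eventually.of_forall fun s _ => hM (κ k) s)
        intervalIntegrable_const (Eventually.of_forall fun s _ => ?_)
      have h1 := tendsto_integral_of_continuous (hg s)
        (hφ.continuous_fokkerPlanckAdjoint hD_cont lam m)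
      -- The consistency error is uniform over measures, so it vanishes along the moving `G (κ k)
      -- s`.
      have h2 := squeeze_zero_norm (f := fun k => Q φ (κ k) s
        - ∫ w : Opinion, fokkerPlanckAdjoint D lam m φ w ∂(G (κ k) s : Measure Opinion))
        (fun k => hQε (κ k) s) (hε.comp hκ.tendsto_atTop)
      simpa using h2.add h1
    simp only [fun n => (hint n).2] at hlim
    have h := tendsto_nhds_unique hlim
      ((tendsto_integral_of_continuous (hg t) hφ.continuous_restrict).sub_const _)
    linarith
  refine ⟨κ, hκ, g, fun τ hτ => ?_, fun τ hτ => ?_,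
    isWeakFokkerPlanckSolution_of_integral_eq hD_cont hg_cont heq, fun τ _ => hgmean τ⟩
  · simpa [hG, max_eq_left hτ] using hg τ
  -- A single Maxwellian kernel, here the one of index `0`, already forces the decay of `D` at the
  -- boundary, with the constant `1 / σ 0 ^ 2`.
  · refine noExtremeMass_of_integral_eq hD_cont hδ_pos hδ_le hlam.le (abs_meanOpinion_le f₀)
      (c := 1 / σ 0 ^ 2) (by positivity) (fun r hr => ?_) hf₀ hg_cont heq hτ
    have hσ0 := hσ 0
    have h := (hmax 0).sq_mul_diffusion_sq_le (Set.Ioo_subset_Icc_self (hγ1 0)) hD_nonneg hν_symm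
      hν_var hr
    rw [one_div_mul_eq_div, le_div_iff₀ (by positivity)]
    linarith
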